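/- **Justness is feasible for CCS, ABC and CCSS, with or without infinitary choice.** *Languages.* Fix sets of agent identifiers $A$, handshake names $\mathscr C$, broadcast names $\mathscr B$ and signals $\mathscr S$, and a family $\mathcal I$ of index sets. Actions are $\tau$, $c$, $\bar c$ ($c\in\mathscr C$), $b!$, $b?$ ($b\in\mathscr B$) and $s$ ($s\in\mathscr S$, reading a signal); put $\mathit{Rec}=\{b?\mid b\in\mathscr B\}$. Processes are $$P ::= \mathbf 0\mid \alpha.P\mid P+Q\mid \textstyle\sum_{i\in I}P_i\ (I\in\mathcal I)\mid P|Q\mid P\backslash L\ (L\subseteq\mathscr C\cup\mathscr S)\mid P[f]\mid A\mid P\hat{\ }s,$$ where a relabelling $f$ maps each of $\mathscr C,\mathscr B,\mathscr S$ to itself, and each identifier has a defining equation $A\stackrel{\rm def}{=}P$. CCS is the case $\mathscr B=\mathscr S=\emptyset$, ABC the case $\mathscr S=\emptyset$ with all defining equations guarded (each identifier in $P$ is in the scope of a prefix), and CCSS the case $\mathscr B=\emptyset$. If $\mathcal I$ is empty there is no infinitary choice; $\mathcal I$ may also consist of all sets (of a universe). *Semantics.* Transitions $P\xrightarrow{\alpha}Q$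 are derived by the usual CCS rules for prefix, choice, parallel composition (interleaving of all labels but $b!,b?$, and synchronisation of $c$ with $\bar c$ to $\tau$), restriction, relabelling and identifiers, by the rule $P_j\xrightarrow{\alpha}P_j'\ \Rightarrow\ \sum_{i\in I}P_i\xrightarrow{\alpha}P_j'$ ($j\in I$), and by: broadcast: if $P\xrightarrow{b\sharp_1}P'$ and $Q\xrightarrow{b\sharp_2}Q'$ then $P|Q\xrightarrow{b\sharp}P'|Q'$ with $\sharp=\,?$ if $\sharp_1=\sharp_2=\,?$ and $\sharp=\,!$ if exactly one of them is $!$; and if $P\xrightarrow{b\sharp}P'$ while $Q$ has no $b?$-transition then $P|Q\xrightarrow{b\sharp}P'|Q$, and symmetrically; signals: $P\hat{\ }s$ emits $s$; emission is written $P\xrightarrow{\bar s}P$ and never changes the state; $+$, $\sum$, $|$, $A$, $\hat{\ }r$, relabelling (with $s$ renamed to $f(s)$) and restriction (if $s\notin L$) pass on the emissions of their arguments; a reading $s$ synchronises with an emission $\bar s$ to $\tau$; and $P\xrightarrow{\alpha}P'$ implies $P\hat{\ }r\xrightarrow{\alpha}P'$. *Transition system.* States are processes and transitions are *derivations* of transitions,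 with the evident source, target and label. $\mathit{Act}$ is the set of actions. Emissions may either be regarded as mere predicates on states, or be included as (indicator) transitions, with labels outside $\mathit{Act}$. A *path* is a finite or infinite alternating sequence of states and consecutive transitions with labels in $\mathit{Act}$. *Concurrency.* A *synchron* of a derivation is a path in its proof tree from the root to a leaf: a string of arguments $+_L,+_R,\sum^j,|_L,|_R,\backslash L,[f],A{:},\hat{\ }r$ followed by its leaf, which is an instance of the prefix axiom ($\alpha.P\xrightarrow{\alpha}P$; the synchron is then *active*) or of the signal axiom. The arguments $|_L,|_R,\backslash L,[f]$ are *static*, and $\mathit{static}(\sigma)$ is $\sigma$ without its other arguments. Write $\varsigma\leadsto\varsigma'$ if $\varsigma'=\varsigma$, or $\varsigma=\sigma|_D\varsigma_2$ and $\varsigma'=\mathit{static}(\sigma)|_D\varsigma_2$ for some $\sigma,D,\varsigma_2$. Write $\varsigma\smile_d\upsilon$ if $\varsigma=\sigma|_D\varsigma_2$ and $\upsilon=\sigma|_E\upsilon_2$ with $\{D,E\}=\{L,R\}$; and $\varsigma'\smile\upsilon'$ if $\varsigma\leadsto\varsigma'$, $\upsilon\leadsto\upsilon'$ for some $\varsigma\smile_d\upsilon$.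 The *necessary* synchrons of a derivation $t$ are all its synchrons, except that if $t$ has a label $b!$ only the synchron whose leaf is a broadcast prefix is necessary. Transition $t$ is *unaffected by* $u$ if $\varsigma\smile\upsilon$ for all necessary synchrons $\varsigma$ of $t$ and all active synchrons $\upsilon$ of $u$; otherwise $u$ *interferes with* $t$. *Justness.* Let $\mathit{Rec}\subseteq B\subseteq\mathit{Act}$. A path $\pi$ is *$B$-just* if for each suffix $\pi'$ of $\pi$ and each transition $t$ with $\ell(t)\in\mathit{Act}\setminus B$ whose source is the first state of $\pi'$, a transition that interferes with $t$ occurs in $\pi'$. **Claim.** For CCS, for ABC, and for CCSS (with emissions as predicates as well as with emissions as indicator transitions), for every family $\mathcal I$ of index sets and every $B$ with $\mathit{Rec}\subseteq B\subseteq\mathit{Act}$, $B$-justness is *feasible*: every finite path is a prefix of a $B$-just path. This holds although, if $\mathcal I$ contains an uncountable set, each of these languages has a process with uncountably many outgoing transitions that are labelled in $\mathit{Act}\setminus\mathit{Rec}$. -/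

import Mathlib

namespace Justness

/-! ## Labelled transition systems, paths, justness, feasibility -/

section LTS

universe u v w

/-- A labelled transition system over a structured set of labels `Rec ⊆ Act ⊆ Lab`, together with a
binary relation `conc` between transitions (`conc t u`: `t` is unaffected by `u`). Transitions whose
label lies outside `Act` are indicator transitions; `Rec` is the set of receptive actions. -/
structure LTSC (Lab : Type w) where
  State : Type u
  Tr : Type v
  src : Tr → State
  tgt : Tr → State
  lab : Tr → Lab
  Act : Set Lab
  Rec : Set Lab
  conc : Tr → Tr → Prop

variable {Lab : Type w}

namespace LTSC

/-- The state reached after `n` steps of an alternating sequence that begins in `s₀` and whose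
transitions are listed by `steps`; it is `none` if the sequence has fewer than `n` transitions. -/
def stateAt (T : LTSC.{u, v, w} Lab) (s₀ : T.State) (steps : ℕ → Option T.Tr) :
    ℕ → Option T.State
  | 0 => some s₀
  | n + 1 => (steps n).map T.tgt

/-- A finite or infinite path `s₀ t₁ s₁ t₂ s₂ ⋯` of states and non-indicator transitions; `steps n`
is the transition `t_{n+1}`, if there is one. By `chain` a transition number `n` can only be present
if all earlier ones are, and it starts in the state reached so far. -/
structure Path (T : LTSC.{u, v, w} Lab) where
  start : T.State
  steps : ℕ → Option T.Tr
  chain : ∀ n t, steps n = some t → T.stateAt start steps n = some (T.src t)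
  nonIndicator : ∀ n t, steps n = some t → T.lab t ∈ T.Act

variable {T : LTSC.{u, v, w} Lab}

/-- The `n`-th state of a path, if it exists. -/
def Path.state (π : T.Path) (n : ℕ) : Option T.State := T.stateAt π.start π.steps n

/-- The path ends in a state. -/
def Path.IsFinite (π : T.Path) : Prop := ∃ n, π.steps n = none

/-- `π` is a prefix of `ρ`. -/
def Path.IsPrefix (π ρ : T.Path) : Prop :=
  π.start = ρ.start ∧ ∀ n t, π.steps n = some t → ρ.steps n = some t

/-- The non-blocking transitions: those labelled by an action that is neither receptive nor in
`B`. -/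
def NonBlocking (T : LTSC.{u, v, w} Lab) (B : Set Lab) (t : T.Tr) : Prop :=
  T.lab t ∈ T.Act ∧ T.lab t ∉ T.Rec ∧ T.lab t ∉ B

/-- `B`-justness: for each suffix of `π` (the one that begins with the `n`-th state `s`) and each
non-blocking transition `t` enabled in `s`, some transition `u` that interferes with `t` occurs in
that suffix. -/
def Path.IsJust (π : T.Path) (B : Set Lab) : Prop :=
  ∀ n s, π.state n = some s → ∀ t, T.NonBlocking B t → T.src t = s →
    ∃ m u, n ≤ m ∧ π.steps m = some u ∧ ¬ T.conc t u

/-- A completeness criterion (a predicate on paths) is feasible if every finite path is a prefix of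
a path that satisfies it. -/
def Feasible (T : LTSC.{u, v, w} Lab) (C : T.Path → Prop) : Prop :=
  ∀ π : T.Path, π.IsFinite → ∃ ρ : T.Path, π.IsPrefix ρ ∧ C ρ

/-- `B`-justness is feasible for every set `B` of blocking actions with `Rec ⊆ B ⊆ Act`. -/
def JustnessFeasible (T : LTSC.{u, v, w} Lab) : Prop :=
  ∀ B : Set Lab, T.Rec ⊆ B → B ⊆ T.Act → T.Feasible (fun π => π.IsJust B)

/-- Some state has uncountably many outgoing transitions that are neither indicator transitions nor
receptive. -/
def UncountablyBranching (T : LTSC.{u, v, w} Lab) : Prop :=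
  ∃ s : T.State, ¬ {t : T.Tr | T.NonBlocking ∅ t ∧ T.src t = s}.Countable

end LTSC

end LTS

/-! ## Labels -/

/-- `send` is the `!` of a broadcast action, `receive` the `?` of a receive action. -/
inductive BMode
  | send
  | receive

/-- The partial composition on `{!, ?}` used for synchronising on a broadcast name. -/
def BMode.comp : BMode → BMode → Option BMode
  | .send, .send => none
  | .send, .receive => some .send
  | .receive, .send => some .send
  | .receive, .receive => some .receive

section Language

universe u₁ u₂ u₃ u₄ u₅ u₆

/-- The actions: `τ`, handshake names `c`, co-names `c̄`, the broadcasts `b!` and receives `b?`, and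
the readings of signals `s`. -/
inductive Action (Ch : Type u₂) (Bc : Type u₃) (Sg : Type u₄)
  | tau
  | name (c : Ch)
  | coname (c : Ch)
  | bro (m : BMode) (b : Bc)
  | sig (s : Sg)

/-- The labels of derivations: actions and signal emissions `s̄`. -/
inductive Label (Ch : Type u₂) (Bc : Type u₃) (Sg : Type u₄)
  | act (α : Action Ch Bc Sg)
  | emit (s : Sg)

/-- A relabelling maps each kind of names to itself. -/
structure Relabelling (Ch : Type u₂) (Bc : Type u₃) (Sg : Type u₄) where
  ch : Ch → Ch
  bc : Bc → Bc
  sg : Sg → Sg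

variable {Ag : Type u₁} {Ch : Type u₂} {Bc : Type u₃} {Sg : Type u₄} {J : Type u₅}
  {I : J → Type u₆}

def Relabelling.onAction (f : Relabelling Ch Bc Sg) : Action Ch Bc Sg → Action Ch Bc Sg
  | .tau => .tau
  | .name c => .name (f.ch c)
  | .coname c => .coname (f.ch c)
  | .bro m b => .bro m (f.bc b)
  | .sig s => .sig (f.sg s)

def Relabelling.onLabel (f : Relabelling Ch Bc Sg) : Label Ch Bc Sg → Label Ch Bc Sg
  | .act α => .act (f.onAction α)
  | .emit s => .emit (f.sg s)

/-- `ℓ ∈ L ∪ L̄`, for a set `L` of handshake names and signals. -/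
def Label.Restricted (L : Set (Ch ⊕ Sg)) : Label Ch Bc Sg → Prop
  | .act (.name c) => Sum.inl c ∈ L
  | .act (.coname c) => Sum.inl c ∈ L
  | .act (.sig s) => Sum.inr s ∈ L
  | .emit s => Sum.inr s ∈ L
  | .act .tau => False
  | .act (.bro _ _) => False

/-- `ℓ` is of the form `b!` or `b?`. -/
def Label.IsBroadcast (ℓ : Label Ch Bc Sg) : Prop := ∃ m b, ℓ = .act (.bro m b)

/-- The two labels are complementary: `c` and `c̄`, or `s` and `s̄`, in either order. -/
inductive Label.Compl : Label Ch Bc Sg → Label Ch Bc Sg → Prop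
  | name (c : Ch) : Compl (.act (.name c)) (.act (.coname c))
  | coname (c : Ch) : Compl (.act (.coname c)) (.act (.name c))
  | sig (s : Sg) : Compl (.act (.sig s)) (.emit s)
  | emit (s : Sg) : Compl (.emit s) (.act (.sig s))

/-- The labels that are actions. -/
def actLabels (Ch : Type u₂) (Bc : Type u₃) (Sg : Type u₄) : Set (Label Ch Bc Sg) :=
  {ℓ | ∃ α, ℓ = .act α}

/-- The receptive actions `b?`. -/
def recLabels (Ch : Type u₂) (Bc : Type u₃) (Sg : Type u₄) : Set (Label Ch Bc Sg) :=
  {ℓ | ∃ b, ℓ = .act (.bro .receive b)}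

/-! ## Processes -/

/-- Process expressions over agent identifiers `Ag`, handshake names `Ch`, broadcast names `Bc`
and signals `Sg`. The family `I` lists the index sets over which the infinitary choice operator
`choice` is available: the empty family gives the languages without infinitary choice, and the family
of all types (of a universe) gives unrestricted infinitary choice. -/
inductive Proc (Ag : Type u₁) (Ch : Type u₂) (Bc : Type u₃) (Sg : Type u₄) {J : Type u₅}
    (I : J → Type u₆)
  | nil
  | pre (α : Action Ch Bc Sg) (P : Proc Ag Ch Bc Sg I)
  | sum (P Q : Proc Ag Ch Bc Sg I)
  | choice (k : J) (P : I k → Proc Ag Ch Bc Sg I)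
  | par (P Q : Proc Ag Ch Bc Sg I)
  | res (P : Proc Ag Ch Bc Sg I) (L : Set (Ch ⊕ Sg))
  | rel (P : Proc Ag Ch Bc Sg I) (f : Relabelling Ch Bc Sg)
  | ident (A : Ag)
  | signal (P : Proc Ag Ch Bc Sg I) (s : Sg)

/-- Each agent identifier occurs within the scope of a prefixing operator. -/
def Proc.Guarded : Proc Ag Ch Bc Sg I → Prop
  | .nil => True
  | .pre _ _ => True
  | .sum P Q => P.Guarded ∧ Q.Guarded
  | .choice _ P => ∀ i, (P i).Guarded
  | .par P Q => P.Guarded ∧ Q.Guarded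
  | .res P _ => P.Guarded
  | .rel P _ => P.Guarded
  | .ident _ => False
  | .signal P _ => P.Guarded

/-- With respect to the defining equations `A ≝ D A`, the process admits the action `b?`. By
`canReceive_iff` below this says precisely that it has an outgoing `b?`-transition. It is introduced
first, because the operational rules use its negation as a premise. -/
inductive CanReceive (D : Ag → Proc Ag Ch Bc Sg I) : Proc Ag Ch Bc Sg I → Bc → Prop
  | pre (b P) : CanReceive D (.pre (.bro .receive b) P) b
  | sumL {P b} (Q) : CanReceive D P b → CanReceive D (.sum P Q) b
  | sumR {Q b} (P) : CanReceive D Q b → CanReceive D (.sum P Q) b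
  | choice {k b} (P : I k → Proc Ag Ch Bc Sg I) (j : I k) :
      CanReceive D (P j) b → CanReceive D (.choice k P) b
  | parL {P b} (Q) : CanReceive D P b → CanReceive D (.par P Q) b
  | parR {Q b} (P) : CanReceive D Q b → CanReceive D (.par P Q) b
  | res {P b} (L) : CanReceive D P b → CanReceive D (.res P L) b
  | rel {P b} (f : Relabelling Ch Bc Sg) : CanReceive D P b → CanReceive D (.rel P f) (f.bc b)
  | ident {A b} : CanReceive D (D A) b → CanReceive D (.ident A) b
  | signal {P b} (s) : CanReceive D P b → CanReceive D (.signal P s) b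

/-- The derivations of `P --ℓ--> Q` from the operational rules. A derivation with label `s̄`
derives that `P` emits the signal `s`; it has `Q = P`, see `Der.emit_target`.

The rules up to `ident` are those of CCS with infinitary choice, then come the rules for broadcast
communication, and then those for signals. -/
inductive Der (D : Ag → Proc Ag Ch Bc Sg I) :
    Proc Ag Ch Bc Sg I → Label Ch Bc Sg → Proc Ag Ch Bc Sg I →
      Type (max u₁ u₂ u₃ u₄ u₅ u₆)
  | pre (α P) : Der D (.pre α P) (.act α) P
  | sumL {P P' α} (χ : Der D P (.act α) P') (Q) : Der D (.sum P Q) (.act α) P'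
  | sumR {Q Q' α} (P) (χ : Der D Q (.act α) Q') : Der D (.sum P Q) (.act α) Q'
  | choice {k P' α} (P : I k → Proc Ag Ch Bc Sg I) (j : I k) (χ : Der D (P j) (.act α) P') :
      Der D (.choice k P) (.act α) P'
  | parL {P P' η} (χ : Der D P η P') (Q) (h : ¬ η.IsBroadcast) :
      Der D (.par P Q) η (.par P' Q)
  | parR {Q Q' η} (P) (ζ : Der D Q η Q') (h : ¬ η.IsBroadcast) :
      Der D (.par P Q) η (.par P Q')
  | comm {P P' Q Q' c c'} (χ : Der D P c P') (ζ : Der D Q c' Q') (h : Label.Compl c c') :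
      Der D (.par P Q) (.act .tau) (.par P' Q')
  | res {P P' ℓ} (χ : Der D P ℓ P') (L) (h : ¬ ℓ.Restricted L) :
      Der D (.res P L) ℓ (.res P' L)
  | rel {P P' ℓ} (χ : Der D P ℓ P') (f : Relabelling Ch Bc Sg) :
      Der D (.rel P f) (f.onLabel ℓ) (.rel P' f)
  | ident {A P' α} (χ : Der D (D A) (.act α) P') : Der D (.ident A) (.act α) P'
  | broL {P P' m b} (χ : Der D P (.act (.bro m b)) P') (Q) (h : ¬ CanReceive D Q b) :
      Der D (.par P Q) (.act (.bro m b)) (.par P' Q)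
  | broC {P P' Q Q' m₁ m₂ m b} (χ : Der D P (.act (.bro m₁ b)) P')
      (ζ : Der D Q (.act (.bro m₂ b)) Q') (h : m₁.comp m₂ = some m) :
      Der D (.par P Q) (.act (.bro m b)) (.par P' Q')
  | broR {Q Q' m b} (P) (ζ : Der D Q (.act (.bro m b)) Q') (h : ¬ CanReceive D P b) :
      Der D (.par P Q) (.act (.bro m b)) (.par P Q')
  | emit (P s) : Der D (.signal P s) (.emit s) (.signal P s)
  | sumEmitL {P P' s} (χ : Der D P (.emit s) P') (Q) : Der D (.sum P Q) (.emit s) (.sum P' Q)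
  | sumEmitR {Q Q' s} (P) (χ : Der D Q (.emit s) Q') : Der D (.sum P Q) (.emit s) (.sum P Q')
  | choiceEmit {k P' s} (P : I k → Proc Ag Ch Bc Sg I) (j : I k) (χ : Der D (P j) (.emit s) P') :
      Der D (.choice k P) (.emit s) (.choice k P)
  | signalAct {P P' α} (χ : Der D P (.act α) P') (r) : Der D (.signal P r) (.act α) P'
  | signalEmit {P P' s} (χ : Der D P (.emit s) P') (r) :
      Der D (.signal P r) (.emit s) (.signal P' r)
  | identEmit {A P' s} (χ : Der D (D A) (.emit s) P') : Der D (.ident A) (.emit s) (.ident A)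

theorem Der.target_eq {D : Ag → Proc Ag Ch Bc Sg I} {P ℓ Q} (χ : Der D P ℓ Q) :
    ∀ s, ℓ = .emit s → Q = P := by
  induction χ with
  | parL χ Q h ih => intro s hs; rw [ih s hs]
  | parR P ζ h ih => intro s hs; rw [ih s hs]
  | res χ L h ih => intro s hs; rw [ih s hs]
  | @rel P P' ℓ χ f ih =>
    intro s hs
    cases ℓ with
    | act α => simp [Relabelling.onLabel] at hs
    | emit s' => rw [ih s' rfl]
  | sumEmitL χ Q ih => intro s hs; rw [ih _ rfl]
  | sumEmitR P χ ih => intro s hs; rw [ih _ rfl]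
  | signalEmit χ r ih => intro s hs; rw [ih _ rfl]
  | _ => intro s hs; first | rfl | simp at hs

/-- A signal emission does not change the state. -/
theorem Der.emit_target {D : Ag → Proc Ag Ch Bc Sg I} {P s Q} (χ : Der D P (.emit s) Q) : Q = P :=
  χ.target_eq s rfl

theorem canReceive_of_der {D : Ag → Proc Ag Ch Bc Sg I} {P ℓ Q} (χ : Der D P ℓ Q) :
    ∀ b, ℓ = .act (.bro .receive b) → CanReceive D P b := by
  induction χ with
  | pre α P => rintro b ⟨⟩; exact .pre b P
  | sumL χ Q ih => intro b hb; exact .sumL Q (ih b hb)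
  | sumR P χ ih => intro b hb; exact .sumR P (ih b hb)
  | choice P j χ ih => intro b hb; exact .choice P j (ih b hb)
  | parL χ Q h ih => intro b hb; exact absurd ⟨_, _, hb⟩ h
  | parR P ζ h ih => intro b hb; exact absurd ⟨_, _, hb⟩ h
  | comm χ ζ h => intro b hb; simp at hb
  | res χ L h ih => intro b hb; exact .res L (ih b hb)
  | @rel P P' ℓ χ f ih =>
    intro b hb
    rcases ℓ with α | s
    · cases α with
      | bro m b' =>
        simp only [Relabelling.onLabel, Relabelling.onAction, Label.act.injEq,
          Action.bro.injEq] at hb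
        obtain ⟨rfl, rfl⟩ := hb
        exact .rel f (ih b' rfl)
      | _ => simp [Relabelling.onLabel, Relabelling.onAction] at hb
    · simp [Relabelling.onLabel] at hb
  | ident χ ih => intro b hb; exact .ident (ih b hb)
  | broL χ Q h ih => intro b hb; exact .parL Q (ih b hb)
  | @broC P P' Q Q' m₁ m₂ m b χ ζ h ih₁ ih₂ =>
    intro b' hb
    simp only [Label.act.injEq, Action.bro.injEq] at hb
    obtain ⟨rfl, rfl⟩ := hb
    cases m₁ with
    | receive => exact .parL _ (ih₁ _ rfl)
    | send => cases m₂ <;> simp [BMode.comp] at h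
  | broR P ζ h ih => intro b hb; exact .parR P (ih b hb)
  | signalAct χ r ih => intro b hb; exact .signal r (ih b hb)
  | _ => intro b hb; simp at hb

theorem der_of_canReceive_aux {D : Ag → Proc Ag Ch Bc Sg I} (P : Proc Ag Ch Bc Sg I)
    (H : P.Guarded ∨ ∀ A b, CanReceive D (D A) b →
      ∃ Q, Nonempty (Der D (D A) (.act (.bro .receive b)) Q)) :
    ∀ b, CanReceive D P b → ∃ Q, Nonempty (Der D P (.act (.bro .receive b)) Q) := by
  induction P with
  | nil => intro b h; cases h
  | pre α P _ => intro b h; cases h; exact ⟨_, ⟨.pre _ P⟩⟩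
  | sum P Q ihP ihQ =>
    intro b h
    cases h with
    | sumL _ h => obtain ⟨R, ⟨χ⟩⟩ := ihP (H.imp_left And.left) b h; exact ⟨_, ⟨.sumL χ Q⟩⟩
    | sumR _ h => obtain ⟨R, ⟨χ⟩⟩ := ihQ (H.imp_left And.right) b h; exact ⟨_, ⟨.sumR P χ⟩⟩
  | choice k P ih =>
    intro b h
    cases h with
    | choice _ j h => obtain ⟨R, ⟨χ⟩⟩ := ih j (H.imp_left (· j)) b h; exact ⟨_, ⟨.choice P j χ⟩⟩
  | par P Q ihP ihQ =>
    intro b h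
    have ihP := ihP (H.imp_left And.left) b
    have ihQ := ihQ (H.imp_left And.right) b
    by_cases hP : CanReceive D P b <;> by_cases hQ : CanReceive D Q b
    · obtain ⟨_, ⟨χ⟩⟩ := ihP hP
      obtain ⟨_, ⟨ζ⟩⟩ := ihQ hQ
      exact ⟨_, ⟨.broC χ ζ rfl⟩⟩
    · obtain ⟨_, ⟨χ⟩⟩ := ihP hP
      exact ⟨_, ⟨.broL χ Q hQ⟩⟩
    · obtain ⟨_, ⟨ζ⟩⟩ := ihQ hQ
      exact ⟨_, ⟨.broR P ζ hP⟩⟩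
    · cases h <;> contradiction
  | res P L ih =>
    intro b h
    cases h with
    | res _ h =>
      obtain ⟨R, ⟨χ⟩⟩ := ih H b h
      exact ⟨_, ⟨.res χ L (fun h => h)⟩⟩
  | rel P f ih =>
    intro b h
    cases h with
    | rel _ h => obtain ⟨R, ⟨χ⟩⟩ := ih H _ h; exact ⟨_, ⟨.rel χ f⟩⟩
  | ident A =>
    intro b h
    cases h with
    | ident h =>
      obtain ⟨R, ⟨χ⟩⟩ := (H.resolve_left id) A b h
      exact ⟨_, ⟨.ident χ⟩⟩
  | signal P s ih =>
    intro b h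
    cases h with
    | signal _ h => obtain ⟨R, ⟨χ⟩⟩ := ih H b h; exact ⟨_, ⟨.signalAct χ s⟩⟩

/-- If all defining equations are guarded, then a process admits `b?` iff it has an outgoing
`b?`-transition. -/
theorem canReceive_iff {D : Ag → Proc Ag Ch Bc Sg I} (hD : ∀ A, (D A).Guarded)
    {P : Proc Ag Ch Bc Sg I} {b : Bc} :
    CanReceive D P b ↔ ∃ Q, Nonempty (Der D P (.act (.bro .receive b)) Q) :=
  ⟨der_of_canReceive_aux P (.inr fun A => der_of_canReceive_aux (D A) (.inl (hD A))) b,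
    fun ⟨_, ⟨χ⟩⟩ => canReceive_of_der χ b rfl⟩

/-! ## Synchrons and the concurrency relation -/

/-- The two sides of a parallel composition. -/
inductive Side
  | left
  | right

/-- The arguments: one for each operand position of each operator other than prefixing. -/
inductive Arg (Ag : Type u₁) (Ch : Type u₂) (Bc : Type u₃) (Sg : Type u₄) {J : Type u₅}
    (I : J → Type u₆)
  | sumL
  | sumR
  | choice (k : J) (j : I k)
  | par (d : Side)
  | res (L : Set (Ch ⊕ Sg))
  | rel (f : Relabelling Ch Bc Sg)
  | ident (A : Ag)
  | signal (r : Sg)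

/-- The arguments of parallel composition, restriction and relabelling are static, the others are
dynamic. -/
def Arg.isStatic : Arg Ag Ch Bc Sg I → Bool
  | .par _ => true
  | .res _ => true
  | .rel _ => true
  | _ => false

/-- The final part of a synchron: an instance of the prefixing axiom, or of the axiom for signal
emission. -/
inductive Leaf (Ag : Type u₁) (Ch : Type u₂) (Bc : Type u₃) (Sg : Type u₄) {J : Type u₅}
    (I : J → Type u₆)
  | act (α : Action Ch Bc Sg) (P : Proc Ag Ch Bc Sg I)
  | emit (P : Proc Ag Ch Bc Sg I) (s : Sg)

/-- A synchron: a string of arguments followed by a leaf. -/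
structure Synchron (Ag : Type u₁) (Ch : Type u₂) (Bc : Type u₃) (Sg : Type u₄) {J : Type u₅}
    (I : J → Type u₆) where
  args : List (Arg Ag Ch Bc Sg I)
  leaf : Leaf Ag Ch Bc Sg I

/-- Prefix a synchron by an argument. -/
def Synchron.cons (ι : Arg Ag Ch Bc Sg I) (ς : Synchron Ag Ch Bc Sg I) : Synchron Ag Ch Bc Sg I :=
  ⟨ι :: ς.args, ς.leaf⟩

/-- Active synchrons end in an instance of the prefixing axiom. -/
def Synchron.IsActive (ς : Synchron Ag Ch Bc Sg I) : Prop := ∃ α P, ς.leaf = .act α P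

/-- The synchron ends in `b!.P --b!--> P` for some broadcast name `b`. -/
def Synchron.IsBroadcast (ς : Synchron Ag Ch Bc Sg I) : Prop :=
  ∃ b P, ς.leaf = .act (.bro .send b) P

/-- `ς ⇝ ς'`: either `ς' = ς`, or `ς = σ₁|_d ς₂` and `ς' = static(σ₁)|_d ς₂`. -/
def Synchron.Succ (ς ς' : Synchron Ag Ch Bc Sg I) : Prop :=
  ς' = ς ∨ ∃ σ₁ d σ₂ υ, ς = ⟨σ₁ ++ .par d :: σ₂, υ⟩ ∧
    ς' = ⟨σ₁.filter Arg.isStatic ++ .par d :: σ₂, υ⟩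

/-- `ς` and `υ` are directly concurrent: `ς = σ₁|_d ς₂` and `υ = σ₁|_e υ₂` with `d ≠ e`. -/
def Synchron.DirConc (ς υ : Synchron Ag Ch Bc Sg I) : Prop :=
  ∃ σ₁ d e σ₂ τ₂, d ≠ e ∧ ς.args = σ₁ ++ .par d :: σ₂ ∧ υ.args = σ₁ ++ .par e :: τ₂

/-- Two synchrons are concurrent if they are possible successors of directly concurrent ones. -/
def Synchron.Conc (ς' υ' : Synchron Ag Ch Bc Sg I) : Prop :=
  ∃ ς υ : Synchron Ag Ch Bc Sg I, ς.Succ ς' ∧ ς.DirConc υ ∧ υ.Succ υ'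

/-- The set of synchrons of a derivation. -/
def Der.synchrons {D : Ag → Proc Ag Ch Bc Sg I} {P ℓ Q} :
    Der D P ℓ Q → Set (Synchron Ag Ch Bc Sg I)
  | .pre α P => {⟨[], .act α P⟩}
  | .sumL χ _ => Synchron.cons .sumL '' χ.synchrons
  | .sumR _ χ => Synchron.cons .sumR '' χ.synchrons
  | .choice (k := k) _ j χ => Synchron.cons (.choice k j) '' χ.synchrons
  | .parL χ _ _ => Synchron.cons (.par .left) '' χ.synchrons
  | .parR _ ζ _ => Synchron.cons (.par .right) '' ζ.synchrons
  | .comm χ ζ _ => Synchron.cons (.par .left) '' χ.synchrons ∪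
      Synchron.cons (.par .right) '' ζ.synchrons
  | .res χ L _ => Synchron.cons (.res L) '' χ.synchrons
  | .rel χ f => Synchron.cons (.rel f) '' χ.synchrons
  | .ident (A := A) χ => Synchron.cons (.ident A) '' χ.synchrons
  | .broL χ _ _ => Synchron.cons (.par .left) '' χ.synchrons
  | .broC χ ζ _ => Synchron.cons (.par .left) '' χ.synchrons ∪
      Synchron.cons (.par .right) '' ζ.synchrons
  | .broR _ ζ _ => Synchron.cons (.par .right) '' ζ.synchrons
  | .emit P s => {⟨[], .emit P s⟩}
  | .sumEmitL χ _ => Synchron.cons .sumL '' χ.synchrons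
  | .sumEmitR _ χ => Synchron.cons .sumR '' χ.synchrons
  | .choiceEmit (k := k) _ j χ => Synchron.cons (.choice k j) '' χ.synchrons
  | .signalAct χ r => Synchron.cons (.signal r) '' χ.synchrons
  | .signalEmit χ r => Synchron.cons (.signal r) '' χ.synchrons
  | .identEmit (A := A) χ => Synchron.cons (.ident A) '' χ.synchrons

/-- The active synchrons of a derivation. -/
def Der.activeSynchrons {D : Ag → Proc Ag Ch Bc Sg I} {P ℓ Q} (χ : Der D P ℓ Q) :
    Set (Synchron Ag Ch Bc Sg I) :=
  {ς ∈ χ.synchrons | ς.IsActive}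

/-- The necessary synchrons of a derivation: only the broadcasting one if the label is `b!`, and all
of them otherwise. (This notion is not used for derivations with a label `b?`.) -/
def Der.necessarySynchrons {D : Ag → Proc Ag Ch Bc Sg I} {P ℓ Q} (χ : Der D P ℓ Q) :
    Set (Synchron Ag Ch Bc Sg I) :=
  {ς ∈ χ.synchrons | (∃ b, ℓ = .act (.bro .send b)) → ς.IsBroadcast}

/-- `χ` is unaffected by `ζ`: each necessary synchron of `χ` is concurrent with each active synchron
of `ζ`. -/
def Der.Unaffected {D : Ag → Proc Ag Ch Bc Sg I} {P ℓ Q P' ℓ' Q'} (χ : Der D P ℓ Q)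
    (ζ : Der D P' ℓ' Q') : Prop :=
  ∀ ς ∈ χ.necessarySynchrons, ∀ υ ∈ ζ.activeSynchrons, ς.Conc υ

/-! ## The transition systems of the languages -/

/-- A derivation together with its source, label and target. -/
structure Derivation (D : Ag → Proc Ag Ch Bc Sg I) where
  source : Proc Ag Ch Bc Sg I
  label : Label Ch Bc Sg
  target : Proc Ag Ch Bc Sg I
  der : Der D source label target

/-- The transition system in which every derivation is a transition. Signal emissions are its
indicator transitions. -/
def fullLTSC (D : Ag → Proc Ag Ch Bc Sg I) : LTSC (Label Ch Bc Sg) where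
  State := Proc Ag Ch Bc Sg I
  Tr := Derivation D
  src t := t.source
  tgt t := t.target
  lab t := t.label
  Act := actLabels Ch Bc Sg
  Rec := recLabels Ch Bc Sg
  conc t u := t.der.Unaffected u.der

/-- The transition system in which only the derivations labelled by an action are transitions.
Signal emissions are treated as predicates on states. -/
def actionLTSC (D : Ag → Proc Ag Ch Bc Sg I) : LTSC (Label Ch Bc Sg) where
  State := Proc Ag Ch Bc Sg I
  Tr := {t : Derivation D // t.label ∈ actLabels Ch Bc Sg}
  src t := t.1.source
  tgt t := t.1.target
  lab t := t.1.label
  Act := actLabels Ch Bc Sg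
  Rec := recLabels Ch Bc Sg
  conc t u := t.1.der.Unaffected u.1.der

/-- CCS expressions: there are no broadcast names and no signals. -/
abbrev CCS (Ag : Type u₁) (Ch : Type u₂) {J : Type u₅} (I : J → Type u₆) :=
  Proc Ag Ch Empty Empty I

/-- ABC expressions: there are no signals. -/
abbrev ABC (Ag : Type u₁) (Ch : Type u₂) (Bc : Type u₃) {J : Type u₅} (I : J → Type u₆) :=
  Proc Ag Ch Bc Empty I

/-- CCSS expressions: there are no broadcast names. -/
abbrev CCSS (Ag : Type u₁) (Ch : Type u₂) (Sg : Type u₄) {J : Type u₅} (I : J → Type u₆) :=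
  Proc Ag Ch Empty Sg I

end Language

end Justness

open Justness

/-! A process may have uncountably many outgoing transitions, so a scheduler cannot give each of
them a turn. It serves parallel components instead: the `component` of a synchron is the list of
sides taken at parallel compositions before its first dynamic argument. This is a list of Booleans,
so there are only countably many, whatever index sets the choice operator has.

Suppose that `t₀` is enabled, non-blocking, and never interfered with. Each step `u` is then
concurrent with `t₀`, and `t₀` keeps an enabled successor with the same label (`Der.persists`). Its
necessary synchrons are possible successors of those of `t₀`, so concurrency with later steps is
inherited; between derivations from one process, concurrency is direct concurrency
(`Synchron.Conc.dirConc`). One active necessary synchron is followed along the path, with its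
component as key and its number of dynamic arguments (`dynCount`) as rank. A step either discards
some of its dynamic arguments, lowering the rank, or leaves its arguments unchanged.

If `u` has an active synchron in the same component, the two synchrons branch at a parallel
composition, necessarily beyond a dynamic argument, since branching earlier would separate the
components. Executing `u` resolves the dynamic operators above the branching point, so the rank
drops. As the successor of `t₀` itself hits its key, the scheduler can always hit that key when its
turn comes. Every key has infinitely many turns, so the rank would decrease forever.
`LTSC.feasible_isJust_of_marks` isolates this descent from the process algebra.

For a broadcast `b!` only the sender is necessary: receivers may change, and the derivation is
rebuilt with whatever receivers are then present. This needs `CanReceive` to be realised by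
derivations (`ReceiveComplete`), which holds when defining equations are guarded, and trivially
without broadcast names. -/

open Justness
namespace Justness

/-! ## Feasibility of justness from a countable set of keys -/

namespace LTSC

universe u v w x

variable {Lab : Type w} {T : LTSC.{u, v, w} Lab}

/-- The path that follows `π` as long as possible, and from then on takes in state number `n` the
transition proposed by `sched n`. -/
def extendSteps (π : T.Path) (sched : ℕ → T.State → Option T.Tr) (n : ℕ) (s : Option T.State) :
    Option T.Tr :=
  match π.steps n with
  | some t => some t
  | none => s.bind (sched n)

/-- The states of the path obtained from `π` and `sched`. -/
def extendState (π : T.Path) (sched : ℕ → T.State → Option T.Tr) : ℕ → Option T.State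
  | 0 => some π.start
  | n + 1 => (extendSteps π sched n (extendState π sched n)).map T.tgt

/-- As long as `π` still moves, the recomputed states agree with its own, so its transitions remain
composable. -/
theorem extendState_of_steps (π : T.Path) (sched : ℕ → T.State → Option T.Tr) {n : ℕ} {t : T.Tr}
    (h : π.steps n = some t) : extendState π sched n = some (T.src t) := by
  have hc := π.chain n t h
  cases n with
  | zero => exact hc
  | succ n =>
    simp only [stateAt, Option.map_eq_some_iff] at hc
    obtain ⟨t', ht', e⟩ := hc
    simp [extendState, extendSteps, ht', e]

/-- The path obtained from `π` and `sched`. -/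
def extend (π : T.Path) (sched : ℕ → T.State → Option T.Tr)
    (hsrc : ∀ n s t, sched n s = some t → T.src t = s)
    (hact : ∀ n s t, sched n s = some t → T.lab t ∈ T.Act) : T.Path where
  start := π.start
  steps n := extendSteps π sched n (extendState π sched n)
  chain n t h := by
    have e : T.stateAt π.start (fun n => extendSteps π sched n (extendState π sched n)) n =
        extendState π sched n := by cases n <;> rfl
    rw [e]
    cases hp : π.steps n with
    | some t' =>
      obtain rfl : t' = t := by simpa [extendSteps, hp] using h
      exact extendState_of_steps π sched hp
    | none =>
      simp only [extendSteps, hp, Option.bind_eq_some_iff] at h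
      obtain ⟨s, hs, ht⟩ := h
      rw [hs, hsrc _ _ _ ht]
  nonIndicator n t h := by
    cases hp : π.steps n with
    | some t' =>
      obtain rfl : t' = t := by simpa [extendSteps, hp] using h
      exact π.nonIndicator _ _ hp
    | none =>
      simp only [extendSteps, hp, Option.bind_eq_some_iff] at h
      obtain ⟨s, -, ht⟩ := h
      exact hact _ _ _ ht

theorem Path.steps_eq_none_of_le (π : T.Path) {N n : ℕ} (hN : π.steps N = none) (h : N ≤ n) :
    π.steps n = none := by
  induction n, h using Nat.le_induction with
  | base => exact hN
  | succ n _ ih =>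
    by_contra hne
    obtain ⟨t, ht⟩ := Option.ne_none_iff_exists'.1 hne
    have := π.chain _ _ ht
    simp [stateAt, ih] at this

/-- A scheduler that, if possible, picks a non-blocking transition that hits the key `k`, and
otherwise any non-blocking transition. -/
theorem exists_scheduler {K : Type x} (B : Set Lab) (Hits : T.Tr → K → Prop) (k : K)
    (s : T.State) :
    ∃ o : Option T.Tr, (∀ u, o = some u → T.src u = s ∧ T.NonBlocking B u) ∧
      (∀ t, T.NonBlocking B t → T.src t = s → o ≠ none) ∧
      (∀ t, T.NonBlocking B t → T.src t = s → Hits t k → ∃ u, o = some u ∧ Hits u k) := by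
  by_cases h₁ : ∃ t, T.NonBlocking B t ∧ T.src t = s ∧ Hits t k
  · obtain ⟨t, ht, hs, hk⟩ := h₁
    exact ⟨some t, by rintro u ⟨⟩; exact ⟨hs, ht⟩, by simp, fun _ _ _ _ => ⟨t, rfl, hk⟩⟩
  · by_cases h₂ : ∃ t, T.NonBlocking B t ∧ T.src t = s
    · obtain ⟨t, ht, hs⟩ := h₂
      exact ⟨some t, by rintro u ⟨⟩; exact ⟨hs, ht⟩, by simp,
        fun t' h h' h'' => absurd ⟨t', h, h', h''⟩ h₁⟩
    · exact ⟨none, by simp, fun t h h' => absurd ⟨t, h, h'⟩ h₂,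
        fun t' h h' h'' => absurd ⟨t', h, h', h''⟩ h₁⟩

/-- Justness is feasible if each non-blocking transition `t₀` can be given a mark with a key from a
countable set and a rank, in such a way that `t₀` survives as a marked transition as long as no
transition interferes with it; key and rank are then preserved, except that the rank decreases in
certain steps, among which all those that hit the key. -/
theorem feasible_isJust_of_marks {K : Type x} [Countable K] {M : Type*} (B : Set Lab)
    (Marks : T.Tr → T.Tr → M → Prop) (key : M → K) (rank : M → ℕ) (Hits : T.Tr → K → Prop)
    (exists_mark : ∀ t, T.NonBlocking B t → ∃ x, Marks t t x)
    (hits : ∀ t₀ t x, Marks t₀ t x → Hits t (key x))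
    (persist : ∀ t₀ t x u, T.NonBlocking B t₀ → T.NonBlocking B t → Marks t₀ t x →
      T.src u = T.src t → T.lab u ∈ T.Act → T.conc t₀ u →
      ∃ t' x', T.NonBlocking B t' ∧ T.src t' = T.tgt u ∧ Marks t₀ t' x' ∧
        (rank x' < rank x ∨ key x' = key x ∧ rank x' = rank x ∧ ¬ Hits u (key x))) :
    T.Feasible (fun π => π.IsJust B) := by
  rintro π ⟨N, hN⟩
  by_cases hK : Nonempty K
  swap
  -- Without keys there are no marks, hence no non-blocking transitions, and `π` itself is just.
  · refine ⟨π, ⟨rfl, fun _ _ h => h⟩, fun n s _ t ht _ => ?_⟩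
    obtain ⟨x, -⟩ := exists_mark t ht
    exact absurd ⟨key x⟩ hK
  obtain ⟨e, he⟩ := exists_surjective_nat K
  choose o ho₁ ho₂ ho₃ using exists_scheduler (T := T) B Hits
  -- Through unpairing, each key has its turn at infinitely many positions.
  let sched : ℕ → T.State → Option T.Tr := fun n => o (e n.unpair.1)
  let ρ : T.Path := extend π sched (fun n s t h => (ho₁ _ _ _ h).1)
    (fun n s t h => (ho₁ _ _ _ h).2.1)
  have hstate : ∀ n, ρ.state n = extendState π sched n := fun n => by cases n <;> rfl
  have hsteps : ∀ n s, N ≤ n → ρ.state n = some s → ρ.steps n = sched n s := by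
    intro n s hn hs
    rw [hstate] at hs
    change extendSteps π sched n (extendState π sched n) = _
    simp [extendSteps, π.steps_eq_none_of_le hN hn, hs]
  refine ⟨ρ, ⟨rfl, fun n t h => ?_⟩, fun n s hs t₀ ht₀ hsrc => ?_⟩
  · change extendSteps π sched n _ = _
    simp [extendSteps, h]
  by_contra! hcon
  -- a marked descendant of `t₀` in state `m` yields one in state `m + 1`
  have next : ∀ m t x, n ≤ m → ρ.state m = some (T.src t) → T.NonBlocking B t → Marks t₀ t x →
      ∃ u, ρ.steps m = some u ∧ ∃ t' x', T.NonBlocking B t' ∧ ρ.state (m + 1) = some (T.src t') ∧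
        Marks t₀ t' x' ∧
        (rank x' < rank x ∨ key x' = key x ∧ rank x' = rank x ∧ ¬ Hits u (key x)) := by
    intro m t x hm hst ht hx
    -- The path cannot stop here: either `π` still moves, or the scheduler finds at least the
    -- non-blocking `t`.
    have : ∃ u, ρ.steps m = some u := by
      cases hp : π.steps m with
      | some u =>
        refine ⟨u, ?_⟩
        change extendSteps π sched m _ = _
        simp [extendSteps, hp]
      | none =>
        rw [hstate] at hst
        have := ho₂ (e m.unpair.1) _ t ht rfl
        obtain ⟨u, hu⟩ := Option.ne_none_iff_exists'.1 this
        refine ⟨u, ?_⟩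
        change extendSteps π sched m _ = _
        simp [extendSteps, hp, hst, sched, hu]
    obtain ⟨u, hu⟩ := this
    have hsu : T.src u = T.src t := by
      have := ρ.chain m u hu
      change ρ.state m = _ at this
      rw [hst] at this
      exact (Option.some.inj this).symm
    obtain ⟨t', x', h₁, h₂, h₃, h₄⟩ := persist t₀ t x u ht₀ ht hx hsu (ρ.nonIndicator m u hu)
      (hcon m u hm hu)
    refine ⟨u, hu, t', x', h₁, ?_, h₃, h₄⟩
    change (ρ.steps m).map T.tgt = _
    rw [hu, h₂]
    rfl
  have main : ∀ r m t x, rank x = r → n ≤ m → ρ.state m = some (T.src t) → T.NonBlocking B t →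
      Marks t₀ t x → False := by
    intro r
    induction r using Nat.strong_induction_on with
    | _ r IH =>
      intro m t x hr hm hst ht hx
      -- Any drop in rank is refuted by `IH`, so key and rank may be assumed constant until the turn
      -- of that key.
      have keep : ∀ d, ∃ t' x', T.NonBlocking B t' ∧ ρ.state (m + d) = some (T.src t') ∧
          Marks t₀ t' x' ∧ key x' = key x ∧ rank x' = r := by
        intro d
        induction d with
        | zero => exact ⟨t, x, ht, hst, hx, rfl, hr⟩
        | succ d ih =>
          obtain ⟨t', x', h₁, h₂, h₃, h₄, h₅⟩ := ih
          obtain ⟨u, -, t'', x'', g₁, g₂, g₃, g₄⟩ := next (m + d) t' x' (by omega) h₂ h₁ h₃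
          rcases g₄ with g | ⟨g, g', -⟩
          · exact (IH _ (h₅ ▸ g) (m + d + 1) t'' x'' rfl (by omega) g₂ g₁ g₃).elim
          · exact ⟨t'', x'', g₁, g₂, g₃, g.trans h₄, g'.trans h₅⟩
      obtain ⟨i, hi⟩ := he (key x)
      -- A turn of the key of `x` that comes neither before position `m` nor before the end of `π`.
      let l := Nat.pair i (m + N)
      have hl : m + N ≤ l := Nat.right_le_pair _ _
      obtain ⟨t', x', h₁, h₂, h₃, h₄, h₅⟩ := keep (l - m)
      rw [show m + (l - m) = l by omega] at h₂
      obtain ⟨u, hu, t'', x'', g₁, g₂, g₃, g₄⟩ := next l t' x' (by omega) h₂ h₁ h₃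
      rcases g₄ with g | ⟨-, -, g⟩
      · exact IH _ (h₅ ▸ g) (l + 1) t'' x'' rfl (by omega) g₂ g₁ g₃
      · have hk : e l.unpair.1 = key x' := by simp [l, hi, h₄]
        obtain ⟨u', hu', hh⟩ := ho₃ (key x') _ t' h₁ rfl (hits _ _ _ h₃)
        rw [hsteps l _ (by omega) h₂] at hu
        simp only [sched, hk, hu', Option.some.injEq] at hu
        exact g (hu ▸ hh)
  obtain ⟨x, hx⟩ := exists_mark t₀ ht₀
  exact main _ n t₀ x rfl le_rfl (hsrc ▸ hs) ht₀ hx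

end LTSC

section Synchrons

universe u₁ u₂ u₃ u₄ u₅ u₆

variable {Ag : Type u₁} {Ch : Type u₂} {Bc : Type u₃} {Sg : Type u₄} {J : Type u₅}
  {I : J → Type u₆}

/-! ## Strings of arguments -/

/-- The nontrivial part of the relation `⇝` on strings of arguments. -/
def ArgSucc (l l' : List (Arg Ag Ch Bc Sg I)) : Prop :=
  ∃ σ d τ, l = σ ++ .par d :: τ ∧ l' = σ.filter Arg.isStatic ++ .par d :: τ

theorem ArgSucc.cons_static {x : Arg Ag Ch Bc Sg I} {l l'} (hx : x.isStatic = true)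
    (h : ArgSucc l l') : ArgSucc (x :: l) (x :: l') := by
  obtain ⟨σ, d, τ, rfl, rfl⟩ := h
  exact ⟨x :: σ, d, τ, by simp, by simp [hx]⟩

theorem ArgSucc.cons_dynamic {x : Arg Ag Ch Bc Sg I} {l l'} (hx : x.isStatic = false)
    (h : ArgSucc l l') : ArgSucc (x :: l) l' := by
  obtain ⟨σ, d, τ, rfl, rfl⟩ := h
  exact ⟨x :: σ, d, τ, by simp, by simp [hx]⟩

theorem ArgSucc.par_refl (d : Side) (l : List (Arg Ag Ch Bc Sg I)) :
    ArgSucc (.par d :: l) (.par d :: l) :=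
  ⟨[], d, l, rfl, rfl⟩

theorem ArgSucc.of_cons_static {x : Arg Ag Ch Bc Sg I} {l l₁} (hx : x.isStatic = true)
    (h : ArgSucc (x :: l) l₁) : ∃ l', l₁ = x :: l' ∧ (l' = l ∨ ArgSucc l l') := by
  obtain ⟨σ, d, τ, h, rfl⟩ := h
  cases σ with
  | nil =>
    simp only [List.nil_append, List.cons.injEq] at h
    obtain ⟨rfl, rfl⟩ := h
    exact ⟨_, rfl, .inl rfl⟩
  | cons y σ =>
    simp only [List.cons_append, List.cons.injEq] at h
    obtain ⟨rfl, rfl⟩ := h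
    exact ⟨σ.filter Arg.isStatic ++ .par d :: τ, by simp [hx], .inr ⟨σ, d, τ, rfl, rfl⟩⟩

/-- The splitting parallel argument is static, so a dynamic head lies in the filtered prefix and is
dropped. -/
theorem ArgSucc.of_cons_dynamic {x : Arg Ag Ch Bc Sg I} {l l₁} (hx : x.isStatic = false)
    (h : ArgSucc (x :: l) l₁) : ArgSucc l l₁ := by
  obtain ⟨σ, d, τ, h, rfl⟩ := h
  cases σ with
  | nil =>
    simp only [List.nil_append, List.cons.injEq] at h
    obtain ⟨rfl, rfl⟩ := h
    simp [Arg.isStatic] at hx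
  | cons y σ =>
    simp only [List.cons_append, List.cons.injEq] at h
    obtain ⟨rfl, rfl⟩ := h
    exact ⟨σ, d, τ, rfl, by simp [hx]⟩

/-- The filtered prefix is static, and if it is empty the parallel argument comes first. This
distinguishes a string from which a dynamic head was dropped from one that still has it. -/
theorem ArgSucc.head_static {l l₁ : List (Arg Ag Ch Bc Sg I)} (h : ArgSucc l l₁) :
    ∃ y l', l₁ = y :: l' ∧ y.isStatic = true := by
  obtain ⟨σ, d, τ, rfl, rfl⟩ := h
  cases h : σ.filter Arg.isStatic with
  | nil => exact ⟨.par d, τ, rfl, rfl⟩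
  | cons y l =>
    refine ⟨y, _, rfl, ?_⟩
    have : y ∈ σ.filter Arg.isStatic := by simp [h]
    exact (List.mem_filter.1 this).2

theorem ArgSucc.trans {l₁ l₂ l₃ : List (Arg Ag Ch Bc Sg I)} (h₁ : ArgSucc l₁ l₂)
    (h₂ : ArgSucc l₂ l₃) : ArgSucc l₁ l₃ := by
  induction l₁ generalizing l₂ l₃ with
  | nil => obtain ⟨σ, d, τ, h, -⟩ := h₁; simp at h
  | cons x l ih =>
    cases hx : x.isStatic with
    | false => exact .cons_dynamic hx (ih (h₁.of_cons_dynamic hx) h₂)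
    | true =>
      obtain ⟨l₂, rfl, h | h⟩ := h₁.of_cons_static hx
      · rwa [← h]
      · obtain ⟨l₃, rfl, h' | h'⟩ := h₂.of_cons_static hx
        · rw [h']; exact h₁
        · exact .cons_static hx (ih h h')

/-- The number of dynamic arguments in a string of arguments. -/
def dynCount (l : List (Arg Ag Ch Bc Sg I)) : ℕ := l.countP (fun x => !x.isStatic)

/-- Only dynamic arguments are deleted, so a string that keeps its count has lost nothing. -/
theorem ArgSucc.dynCount_lt_or_eq {l l' : List (Arg Ag Ch Bc Sg I)} (h : ArgSucc l l') :
    dynCount l' < dynCount l ∨ l' = l := by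
  induction l generalizing l' with
  | nil => obtain ⟨σ, d, τ, h, -⟩ := h; simp at h
  | cons x l ih =>
    cases hx : x.isStatic with
    | false =>
      left
      rcases ih (h.of_cons_dynamic hx) with h | rfl
      · simp only [dynCount, List.countP_cons, hx] at h ⊢; simp; omega
      · simp [dynCount, hx]
    | true =>
      obtain ⟨l', rfl, rfl | h⟩ := h.of_cons_static hx
      · exact .inr rfl
      · rcases ih h with h | rfl
        · left; simpa [dynCount, List.countP_cons, hx] using h
        · exact .inr rfl

/-- The parallel component to which a synchron belongs: the sides chosen in the parallel
compositions that precede the first dynamic argument. -/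
def component : List (Arg Ag Ch Bc Sg I) → List Bool
  | .par .left :: l => true :: component l
  | .par .right :: l => false :: component l
  | .res _ :: l => component l
  | .rel _ :: l => component l
  | _ => []

/-! ### Possible successors and direct concurrency of synchrons. -/

theorem Synchron.succ_iff {ς ς' : Synchron Ag Ch Bc Sg I} :
    ς.Succ ς' ↔ ς'.leaf = ς.leaf ∧ (ς'.args = ς.args ∨ ArgSucc ς.args ς'.args) := by
  obtain ⟨l, υ⟩ := ς
  obtain ⟨l', υ'⟩ := ς'
  constructor
  · rintro (h | ⟨σ, d, τ, υ₁, h, h'⟩)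
    · cases h; exact ⟨rfl, .inl rfl⟩
    · cases h; cases h'; exact ⟨rfl, .inr ⟨σ, d, τ, rfl, rfl⟩⟩
  · rintro ⟨h, h' | ⟨σ, d, τ, h₁, h₂⟩⟩
    · left; simp_all
    · right; simp only at h h₁ h₂; subst h h₁ h₂; exact ⟨σ, d, τ, _, rfl, rfl⟩

theorem Synchron.Succ.refl (ς : Synchron Ag Ch Bc Sg I) : ς.Succ ς := .inl rfl

theorem Synchron.Succ.trans {ς₁ ς₂ ς₃ : Synchron Ag Ch Bc Sg I} (h₁ : ς₁.Succ ς₂)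
    (h₂ : ς₂.Succ ς₃) : ς₁.Succ ς₃ := by
  rw [succ_iff] at *
  refine ⟨h₂.1.trans h₁.1, ?_⟩
  rcases h₁.2 with h | h
  · rw [← h]; exact h₂.2
  · rcases h₂.2 with h' | h'
    · rw [h']; exact .inr h
    · exact .inr (h.trans h')

/-- By transitivity of `⇝`; this lets the descendants of a transition inherit its being unaffected.
-/
theorem Synchron.Conc.succ_left {ς ς' υ : Synchron Ag Ch Bc Sg I} (h : ς.Conc υ)
    (h' : ς.Succ ς') : ς'.Conc υ := by
  obtain ⟨ς₀, υ₀, h₁, h₂, h₃⟩ := h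
  exact ⟨ς₀, υ₀, h₁.trans h', h₂, h₃⟩

theorem Synchron.not_dirConc_nil (υ : Leaf Ag Ch Bc Sg I) (ζ : Synchron Ag Ch Bc Sg I) :
    ¬ Synchron.DirConc ⟨[], υ⟩ ζ := by
  rintro ⟨σ, d, e, σ₂, τ₂, -, h, -⟩
  simp at h

theorem Synchron.dirConc_cons_iff {x y : Arg Ag Ch Bc Sg I} {ς υ : Synchron Ag Ch Bc Sg I} :
    (ς.cons x).DirConc (υ.cons y) ↔
      (∃ d e, d ≠ e ∧ x = .par d ∧ y = .par e) ∨ x = y ∧ ς.DirConc υ := by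
  constructor
  · rintro ⟨σ, d, e, σ₂, τ₂, hne, h₁, h₂⟩
    cases σ with
    | nil =>
      simp only [cons, List.nil_append, List.cons.injEq] at h₁ h₂
      exact .inl ⟨d, e, hne, h₁.1, h₂.1⟩
    | cons z σ =>
      simp only [cons, List.cons_append, List.cons.injEq] at h₁ h₂
      exact .inr ⟨h₁.1.trans h₂.1.symm, σ, d, e, σ₂, τ₂, hne, h₁.2, h₂.2⟩
  · rintro (⟨d, e, hne, rfl, rfl⟩ | ⟨rfl, σ, d, e, σ₂, τ₂, hne, h₁, h₂⟩)
    · exact ⟨[], d, e, _, _, hne, rfl, rfl⟩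
    · exact ⟨x :: σ, d, e, σ₂, τ₂, hne, by simp [cons, h₁], by simp [cons, h₂]⟩

/-! ## Concurrent synchrons of derivations from the same process -/

/-- The string of arguments leads from the root of the process to a subprocess. -/
inductive ArgPath (D : Ag → Proc Ag Ch Bc Sg I) :
    Proc Ag Ch Bc Sg I → List (Arg Ag Ch Bc Sg I) → Prop
  | nil (P) : ArgPath D P []
  | sumL {P l} (Q) : ArgPath D P l → ArgPath D (.sum P Q) (.sumL :: l)
  | sumR {Q l} (P) : ArgPath D Q l → ArgPath D (.sum P Q) (.sumR :: l)
  | choice {k l} (P : I k → Proc Ag Ch Bc Sg I) (j : I k) :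
      ArgPath D (P j) l → ArgPath D (.choice k P) (.choice k j :: l)
  | parL {P l} (Q) : ArgPath D P l → ArgPath D (.par P Q) (.par .left :: l)
  | parR {Q l} (P) : ArgPath D Q l → ArgPath D (.par P Q) (.par .right :: l)
  | res {P l} (L) : ArgPath D P l → ArgPath D (.res P L) (.res L :: l)
  | rel {P l} (f) : ArgPath D P l → ArgPath D (.rel P f) (.rel f :: l)
  | ident {A l} : ArgPath D (D A) l → ArgPath D (.ident A) (.ident A :: l)
  | signal {P l} (r) : ArgPath D P l → ArgPath D (.signal P r) (.signal r :: l)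

variable {D : Ag → Proc Ag Ch Bc Sg I}

/-- The outermost operator of `P` alone decides whether its arguments are static. -/
theorem ArgPath.isStatic_eq {P : Proc Ag Ch Bc Sg I} {x y l l'} (h : ArgPath D P (x :: l))
    (h' : ArgPath D P (y :: l')) : x.isStatic = y.isStatic := by
  cases h <;> cases h' <;> rfl

theorem ArgPath.tail {P : Proc Ag Ch Bc Sg I} {x l l'} (h : ArgPath D P (x :: l))
    (h' : ArgPath D P (x :: l')) : ∃ P', ArgPath D P' l ∧ ArgPath D P' l' := by
  cases h <;> cases h' <;> exact ⟨_, by assumption, by assumption⟩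

theorem Der.argPath {P ℓ Q} (χ : Der D P ℓ Q) : ∀ ς ∈ χ.synchrons, ArgPath D P ς.args := by
  induction χ with
  | pre | emit => rintro _ rfl; exact .nil _
  | sumL _ _ ih | sumEmitL _ _ ih => rintro _ ⟨ς, h, rfl⟩; exact .sumL _ (ih _ h)
  | sumR _ _ ih | sumEmitR _ _ ih => rintro _ ⟨ς, h, rfl⟩; exact .sumR _ (ih _ h)
  | choice _ _ _ ih | choiceEmit _ _ _ ih => rintro _ ⟨ς, h, rfl⟩; exact .choice _ _ (ih _ h)
  | parL _ _ _ ih | broL _ _ _ ih => rintro _ ⟨ς, h, rfl⟩; exact .parL _ (ih _ h)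
  | parR _ _ _ ih | broR _ _ _ ih => rintro _ ⟨ς, h, rfl⟩; exact .parR _ (ih _ h)
  | comm _ _ _ ih ih' | broC _ _ _ ih ih' =>
    rintro _ (⟨ς, h, rfl⟩ | ⟨ς, h, rfl⟩)
    · exact .parL _ (ih _ h)
    · exact .parR _ (ih' _ h)
  | res _ _ _ ih => rintro _ ⟨ς, h, rfl⟩; exact .res _ (ih _ h)
  | rel _ _ ih => rintro _ ⟨ς, h, rfl⟩; exact .rel _ (ih _ h)
  | ident _ ih | identEmit _ ih => rintro _ ⟨ς, h, rfl⟩; exact .ident (ih _ h)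
  | signalAct _ _ ih | signalEmit _ _ ih => rintro _ ⟨ς, h, rfl⟩; exact .signal _ (ih _ h)

/-- Since `l₁` and `l₂` both start at the root of `P`, the two successor steps must agree on the
common prefix `σ`: each of its dynamic arguments is dropped by both or kept by both. Hence the
strings still branch at the original parallel composition. -/
theorem ArgPath.dirConc_of_succ {d e : Side} (hne : d ≠ e) (υ₁ υ₂ : Leaf Ag Ch Bc Sg I)
    (σ s t : List (Arg Ag Ch Bc Sg I)) : ∀ {P l₁ l₂}, ArgPath D P l₁ → ArgPath D P l₂ →
      (l₁ = σ ++ .par d :: s ∨ ArgSucc (σ ++ .par d :: s) l₁) →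
      (l₂ = σ ++ .par e :: t ∨ ArgSucc (σ ++ .par e :: t) l₂) →
      Synchron.DirConc ⟨l₁, υ₁⟩ ⟨l₂, υ₂⟩ := by
  induction σ with
  | nil =>
    intro P l₁ l₂ p₁ p₂ h₁ h₂
    have aux : ∀ {d : Side} {s l}, (l = .par d :: s ∨ ArgSucc (.par d :: s) l) →
        ∃ s' : List (Arg Ag Ch Bc Sg I), l = .par d :: s' := by
      rintro d s l (h | h)
      · exact ⟨_, h⟩
      · obtain ⟨l', h, -⟩ := h.of_cons_static rfl; exact ⟨_, h⟩
    obtain ⟨s', rfl⟩ := aux h₁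
    obtain ⟨t', rfl⟩ := aux h₂
    exact ⟨[], d, e, s', t', hne, rfl, rfl⟩
  | cons x σ ih =>
    intro P l₁ l₂ p₁ p₂ h₁ h₂
    simp only [List.cons_append] at h₁ h₂
    cases hx : x.isStatic with
    | true =>
      have aux : ∀ {m l : List (Arg Ag Ch Bc Sg I)}, (l = x :: m ∨ ArgSucc (x :: m) l) →
          ∃ l', l = x :: l' ∧ (l' = m ∨ ArgSucc m l') := by
        rintro m l (h | h)
        · exact ⟨_, h, .inl rfl⟩
        · exact h.of_cons_static hx
      obtain ⟨m₁, rfl, g₁⟩ := aux h₁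
      obtain ⟨m₂, rfl, g₂⟩ := aux h₂
      obtain ⟨P', q₁, q₂⟩ := p₁.tail p₂
      exact (Synchron.dirConc_cons_iff (ς := ⟨m₁, υ₁⟩) (υ := ⟨m₂, υ₂⟩)).2
        (.inr ⟨rfl, ih q₁ q₂ g₁ g₂⟩)
    | false =>
      -- One string cannot keep the dynamic `x` while the other drops it, as the latter then has a
      -- static head.
      have aux : ∀ {m m' l l' : List (Arg Ag Ch Bc Sg I)}, l = x :: m →
          ArgSucc (x :: m') l' → ArgPath D P l → ArgPath D P l' → False := by
        rintro m m' l l' rfl h p p'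
        obtain ⟨y, l'', rfl, hy⟩ := h.head_static
        simp [p.isStatic_eq p', hy] at hx
      rcases h₁ with h₁ | h₁ <;> rcases h₂ with h₂ | h₂
      · exact ⟨x :: σ, d, e, s, t, hne, h₁, h₂⟩
      · exact (aux h₁ h₂ p₁ p₂).elim
      · exact (aux h₂ h₁ p₂ p₁).elim
      · exact ih p₁ p₂ (.inr (h₁.of_cons_dynamic hx)) (.inr (h₂.of_cons_dynamic hx))

/-- Concurrent synchrons of derivations from the same process are directly concurrent. -/
theorem Synchron.Conc.dirConc {ς υ : Synchron Ag Ch Bc Sg I} (h : ς.Conc υ)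
    {P : Proc Ag Ch Bc Sg I} (hς : ArgPath D P ς.args) (hυ : ArgPath D P υ.args) :
    ς.DirConc υ := by
  obtain ⟨ς₀, υ₀, h₁, ⟨σ, d, e, s, t, hne, e₁, e₂⟩, h₃⟩ := h
  rw [succ_iff] at h₁ h₃
  rw [e₁] at h₁
  rw [e₂] at h₃
  exact ArgPath.dirConc_of_succ hne ς.leaf υ.leaf σ s t hς hυ h₁.2 h₃.2

end Synchrons

section Persistence

universe u₁ u₂ u₃ u₄ u₅ u₆

variable {Ag : Type u₁} {Ch : Type u₂} {Bc : Type u₃} {Sg : Type u₄} {J : Type u₅}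
  {I : J → Type u₆} {D : Ag → Proc Ag Ch Bc Sg I}

/-! ## Necessary and active synchrons -/

theorem Relabelling.onLabel_eq_bro {f : Relabelling Ch Bc Sg} {ℓ : Label Ch Bc Sg} {m : BMode} :
    (∃ b, f.onLabel ℓ = .act (.bro m b)) ↔ ∃ b, ℓ = .act (.bro m b) := by
  rcases ℓ with (_ | _ | _ | _ | _) | _ <;> simp [onLabel, onAction]

theorem Label.Compl.not_bro {ℓ ℓ' : Label Ch Bc Sg} (h : ℓ.Compl ℓ') (m : BMode) :
    (¬ ∃ b, ℓ = .act (.bro m b)) ∧ ¬ ∃ b, ℓ' = .act (.bro m b) := by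
  cases h <;> simp

theorem Der.necessarySynchrons_eq_image {P ℓ Q P₁ ℓ₁ Q₁} {t : Der D P ℓ Q} {χ : Der D P₁ ℓ₁ Q₁}
    {x : Arg Ag Ch Bc Sg I} (h : t.synchrons = Synchron.cons x '' χ.synchrons)
    (hℓ : (∃ b, ℓ = .act (.bro .send b)) ↔ ∃ b, ℓ₁ = .act (.bro .send b)) :
    t.necessarySynchrons = Synchron.cons x '' χ.necessarySynchrons := by
  ext ς
  simp only [necessarySynchrons, h, hℓ, Set.mem_ofPred_eq, Set.mem_image]
  constructor
  · rintro ⟨⟨ς, h₁, rfl⟩, h₂⟩; exact ⟨ς, ⟨h₁, h₂⟩, rfl⟩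
  · rintro ⟨ς, ⟨h₁, h₂⟩, rfl⟩; exact ⟨⟨ς, h₁, rfl⟩, h₂⟩

theorem Der.activeSynchrons_eq_image {P ℓ Q P₁ ℓ₁ Q₁} {t : Der D P ℓ Q} {χ : Der D P₁ ℓ₁ Q₁}
    {x : Arg Ag Ch Bc Sg I} (h : t.synchrons = Synchron.cons x '' χ.synchrons) :
    t.activeSynchrons = Synchron.cons x '' χ.activeSynchrons := by
  ext ς
  simp only [activeSynchrons, h, Set.mem_ofPred_eq, Set.mem_image]
  constructor
  · rintro ⟨⟨ς, h₁, rfl⟩, h₂⟩; exact ⟨ς, ⟨h₁, h₂⟩, rfl⟩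
  · rintro ⟨ς, ⟨h₁, h₂⟩, rfl⟩; exact ⟨⟨ς, h₁, rfl⟩, h₂⟩

theorem Der.activeSynchrons_eq_union {P ℓ Q P₁ ℓ₁ Q₁ P₂ ℓ₂ Q₂} {t : Der D P ℓ Q}
    {χ : Der D P₁ ℓ₁ Q₁} {ζ : Der D P₂ ℓ₂ Q₂} {x y : Arg Ag Ch Bc Sg I}
    (h : t.synchrons = Synchron.cons x '' χ.synchrons ∪ Synchron.cons y '' ζ.synchrons) :
    t.activeSynchrons =
      Synchron.cons x '' χ.activeSynchrons ∪ Synchron.cons y '' ζ.activeSynchrons := by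
  ext ς
  simp only [activeSynchrons, h, Set.mem_ofPred_eq, Set.mem_image, Set.mem_union]
  constructor
  · rintro ⟨⟨ς, h₁, rfl⟩ | ⟨ς, h₁, rfl⟩, h₂⟩
    exacts [.inl ⟨ς, ⟨h₁, h₂⟩, rfl⟩, .inr ⟨ς, ⟨h₁, h₂⟩, rfl⟩]
  · rintro (⟨ς, ⟨h₁, h₂⟩, rfl⟩ | ⟨ς, ⟨h₁, h₂⟩, rfl⟩)
    exacts [⟨.inl ⟨ς, h₁, rfl⟩, h₂⟩, ⟨.inr ⟨ς, h₁, rfl⟩, h₂⟩]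

theorem Der.necessarySynchrons_eq_synchrons {P ℓ Q} {t : Der D P ℓ Q}
    (h : ¬ ∃ b, ℓ = .act (.bro .send b)) : t.necessarySynchrons = t.synchrons := by
  simp [necessarySynchrons, h]

theorem Der.necessarySynchrons_comm {P c P' Q c' Q'} (χ : Der D P c P') (ζ : Der D Q c' Q')
    (h : Label.Compl c c') : (Der.comm χ ζ h).necessarySynchrons =
      Synchron.cons (.par .left) '' χ.necessarySynchrons ∪
        Synchron.cons (.par .right) '' ζ.necessarySynchrons := by
  rw [necessarySynchrons_eq_synchrons (t := χ) (h.not_bro _).1,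
    necessarySynchrons_eq_synchrons (t := ζ) (h.not_bro _).2,
    necessarySynchrons_eq_synchrons (by simp)]
  rfl

/-- A synchron ending in a broadcast prefix only occurs in derivations of broadcasts. -/
theorem Der.label_of_isBroadcast {P ℓ Q} (χ : Der D P ℓ Q) :
    ∀ ς ∈ χ.synchrons, ς.IsBroadcast → ∃ b, ℓ = .act (.bro .send b) := by
  induction χ with
  | pre α P =>
    rintro _ rfl ⟨b, P', h⟩
    simp only [Leaf.act.injEq] at h
    exact ⟨b, by rw [h.1]⟩
  | emit => rintro _ rfl ⟨b, P', h⟩; simp at h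
  | comm χ ζ h ih ih' =>
    rintro _ (⟨ς, h₁, rfl⟩ | ⟨ς, h₁, rfl⟩) hb
    · exact absurd (ih _ h₁ hb) (h.not_bro _).1
    · exact absurd (ih' _ h₁ hb) (h.not_bro _).2
  | @broC P P' Q Q' m₁ m₂ m b χ ζ h ih ih' =>
    rintro _ (⟨ς, h₁, rfl⟩ | ⟨ς, h₁, rfl⟩) hb
    · obtain ⟨b', e⟩ := ih _ h₁ hb
      cases e
      cases m₂ <;> cases h
      exact ⟨_, rfl⟩
    · obtain ⟨b', e⟩ := ih' _ h₁ hb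
      cases e
      cases m₁ <;> cases h
      exact ⟨_, rfl⟩
  | rel χ f ih =>
    rintro _ ⟨ς, h₁, rfl⟩ hb
    exact Relabelling.onLabel_eq_bro.2 (ih _ h₁ hb)
  | _ =>
    rename_i ih
    rintro _ ⟨ς, h₁, rfl⟩ hb
    exact ih _ h₁ hb

/-- Synchrons of a premise extend to synchrons of the conclusion, so it suffices to pick a suitable
premise: for `comm` one labelled by an action, for a broadcast synchronisation the sending one. -/
theorem Der.exists_synchron {P ℓ Q} (χ : Der D P ℓ Q) : (∃ ς, ς ∈ χ.synchrons) ∧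
    ((∃ α, ℓ = .act α) → ∃ ς ∈ χ.synchrons, ς.IsActive) ∧
    ((∃ b, ℓ = .act (.bro .send b)) → ∃ ς ∈ χ.synchrons, ς.IsBroadcast) := by
  have img : ∀ {x : Arg Ag Ch Bc Sg I} {S S' : Set (Synchron Ag Ch Bc Sg I)} {p q p' q' : Prop},
      Synchron.cons x '' S ⊆ S' → (p' → p) → (q' → q) →
      ((∃ ς, ς ∈ S) ∧ (p → ∃ ς ∈ S, ς.IsActive) ∧ (q → ∃ ς ∈ S, ς.IsBroadcast)) →
      (∃ ς, ς ∈ S') ∧ (p' → ∃ ς ∈ S', ς.IsActive) ∧ (q' → ∃ ς ∈ S', ς.IsBroadcast) := by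
    rintro x S S' p q p' q' hS hp hq ⟨⟨ς, h⟩, h₁, h₂⟩
    refine ⟨⟨_, hS ⟨ς, h, rfl⟩⟩, fun h' => ?_, fun h' => ?_⟩
    · obtain ⟨ς, h, a⟩ := h₁ (hp h'); exact ⟨_, hS ⟨ς, h, rfl⟩, a⟩
    · obtain ⟨ς, h, a⟩ := h₂ (hq h'); exact ⟨_, hS ⟨ς, h, rfl⟩, a⟩
  induction χ with
  | pre α P =>
    refine ⟨⟨_, rfl⟩, fun _ => ⟨_, rfl, α, P, rfl⟩, ?_⟩
    rintro ⟨b, h⟩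
    cases h
    exact ⟨_, rfl, b, P, rfl⟩
  | emit => exact ⟨⟨_, rfl⟩, by simp, by simp⟩
  | @comm P P' Q Q' c c' χ ζ h ih ih' =>
    by_cases hc : ∃ α, c = .act α
    · exact img Set.subset_union_left (fun _ => hc) (by simp) ih
    · refine img Set.subset_union_right (fun _ => ?_) (by simp) ih'
      cases h <;> simp at hc ⊢
  | @broC P P' Q Q' m₁ m₂ m b χ ζ h ih ih' =>
    cases m₁ with
    | send => exact img Set.subset_union_left (fun _ => ⟨_, rfl⟩) (fun _ => ⟨_, rfl⟩) ih
    | receive =>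
      refine img Set.subset_union_right (fun _ => ⟨_, rfl⟩) ?_ ih'
      rintro ⟨b', e⟩
      cases e
      cases m₂ <;> cases h
      exact ⟨_, rfl⟩
  | @rel P P' ℓ χ f ih =>
    refine img subset_rfl ?_ Relabelling.onLabel_eq_bro.1 ih
    rcases ℓ with α | s <;> simp [Relabelling.onLabel]
  | _ =>
    rename_i ih
    exact img subset_rfl id id ih

theorem Der.activeSynchrons_nonempty {P α Q} (χ : Der D P (.act α) Q) :
    χ.activeSynchrons.Nonempty := by
  obtain ⟨ς, h⟩ := χ.exists_synchron.2.1 ⟨α, rfl⟩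
  exact ⟨ς, h⟩

/-- The synchrons of an emission end in the signal axiom. Hence a component that merely emits a
signal counts as idle. -/
theorem Der.activeSynchrons_emit {P s Q} (χ : Der D P (.emit s) Q) :
    χ.activeSynchrons = ∅ := by
  suffices H : ∀ {P ℓ Q} (χ : Der D P ℓ Q) (s), ℓ = .emit s → ∀ ς ∈ χ.synchrons, ¬ ς.IsActive by
    ext ς
    simp only [activeSynchrons, Set.mem_ofPred_eq, Set.mem_empty_iff_false, iff_false, not_and]
    exact H χ s rfl ς
  intro P ℓ Q χ
  induction χ with
  | emit => rintro s - _ rfl ⟨α, P, h⟩; cases h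
  | @rel P P' ℓ χ f ih =>
    rintro s h _ ⟨ς, h₁, rfl⟩
    rcases ℓ with α | s'
    · cases h
    · exact fun ha => ih s' rfl ς h₁ ha
  | pre | comm | broC => intro s h; cases h
  | _ =>
    rename_i ih
    rintro s h _ ⟨ς, h₁, rfl⟩
    first | cases h; done | exact fun ha => ih s h ς h₁ ha

theorem Der.necessarySynchrons_nonempty {P ℓ Q} (χ : Der D P ℓ Q) :
    χ.necessarySynchrons.Nonempty := by
  by_cases h : ∃ b, ℓ = .act (.bro .send b)
  · obtain ⟨ς, h₁, h₂⟩ := χ.exists_synchron.2.2 h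
    exact ⟨ς, h₁, fun _ => h₂⟩
  · rw [necessarySynchrons_eq_synchrons h]
    exact χ.exists_synchron.1

theorem Der.exists_necessary_active {P α Q} (χ : Der D P (.act α) Q) :
    ∃ ς ∈ χ.necessarySynchrons, ς.IsActive := by
  by_cases h : ∃ b, Label.act α = (.act (.bro .send b) : Label Ch Bc Sg)
  · obtain ⟨ς, h₁, h₂⟩ := χ.exists_synchron.2.2 h
    obtain ⟨b, P, e⟩ := h₂
    exact ⟨ς, ⟨h₁, fun _ => ⟨b, P, e⟩⟩, _, _, e⟩
  · rw [necessarySynchrons_eq_synchrons h]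
    exact χ.exists_synchron.2.1 ⟨α, rfl⟩

theorem Der.necessarySynchrons_broC_left {P P' Q Q' b} (χ : Der D P (.act (.bro .send b)) P')
    (ζ : Der D Q (.act (.bro .receive b)) Q') : (Der.broC χ ζ rfl).necessarySynchrons =
      Synchron.cons (.par .left) '' χ.necessarySynchrons := by
  ext ς
  constructor
  · rintro ⟨⟨ς, h, rfl⟩ | ⟨ς, h, rfl⟩, h'⟩
    · exact ⟨ς, ⟨h, h'⟩, rfl⟩
    · have := ζ.label_of_isBroadcast ς h (h' ⟨b, rfl⟩)
      simp at this
  · rintro ⟨ς, ⟨h, h'⟩, rfl⟩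
    exact ⟨.inl ⟨ς, h, rfl⟩, h'⟩

theorem Der.necessarySynchrons_broC_right {P P' Q Q' b} (χ : Der D P (.act (.bro .receive b)) P')
    (ζ : Der D Q (.act (.bro .send b)) Q') : (Der.broC χ ζ rfl).necessarySynchrons =
      Synchron.cons (.par .right) '' ζ.necessarySynchrons := by
  ext ς
  constructor
  · rintro ⟨⟨ς, h, rfl⟩ | ⟨ς, h, rfl⟩, h'⟩
    · have := χ.label_of_isBroadcast ς h (h' ⟨b, rfl⟩)
      simp at this
    · exact ⟨ς, ⟨h, h'⟩, rfl⟩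
  · rintro ⟨ς, ⟨h, h'⟩, rfl⟩
    exact ⟨.inr ⟨ς, h, rfl⟩, h'⟩

/-! ### Broadcasts in an arbitrary environment. -/

/-- Every process that admits a receive action has a transition with that label. -/
def ReceiveComplete (D : Ag → Proc Ag Ch Bc Sg I) : Prop :=
  ∀ P b, CanReceive D P b → ∃ Q, Nonempty (Der D P (.act (.bro .receive b)) Q)

/-- A broadcast is never blocked: `Q` either takes part by receiving or is passed over. Receivers
contribute no necessary synchrons, so both cases give the same set. -/
theorem ReceiveComplete.send_parL (H : ReceiveComplete D) {P P' b}
    (χ : Der D P (.act (.bro .send b)) P') (Q : Proc Ag Ch Bc Sg I) :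
    ∃ R, ∃ t : Der D (.par P Q) (.act (.bro .send b)) R,
      t.necessarySynchrons = Synchron.cons (.par .left) '' χ.necessarySynchrons := by
  by_cases h : CanReceive D Q b
  · obtain ⟨Q', ⟨ζ⟩⟩ := H Q b h
    exact ⟨_, .broC χ ζ rfl, χ.necessarySynchrons_broC_left ζ⟩
  · exact ⟨_, .broL χ Q h, Der.necessarySynchrons_eq_image rfl Iff.rfl⟩

theorem ReceiveComplete.send_parR (H : ReceiveComplete D) {Q Q' b} (P : Proc Ag Ch Bc Sg I)
    (ζ : Der D Q (.act (.bro .send b)) Q') :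
    ∃ R, ∃ t : Der D (.par P Q) (.act (.bro .send b)) R,
      t.necessarySynchrons = Synchron.cons (.par .right) '' ζ.necessarySynchrons := by
  by_cases h : CanReceive D P b
  · obtain ⟨P', ⟨χ⟩⟩ := H P b h
    exact ⟨_, .broC χ ζ rfl, χ.necessarySynchrons_broC_right ζ⟩
  · exact ⟨_, .broR P ζ h, Der.necessarySynchrons_eq_image rfl Iff.rfl⟩

/-! ## Persistence of unaffected transitions -/

/-- Each element of either set is related to an element of the other one. -/
def BiRelated {α : Type*} (r : α → α → Prop) (S S' : Set α) : Prop :=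
  (∀ y ∈ S', ∃ x ∈ S, r x y) ∧ ∀ x ∈ S, ∃ y ∈ S', r x y

theorem BiRelated.union {α : Type*} {r : α → α → Prop} {S₁ S₁' S₂ S₂' : Set α}
    (h₁ : BiRelated r S₁ S₁') (h₂ : BiRelated r S₂ S₂') :
    BiRelated r (S₁ ∪ S₂) (S₁' ∪ S₂') := by
  constructor
  · rintro y (hy | hy)
    · obtain ⟨x, hx, h⟩ := h₁.1 y hy; exact ⟨x, .inl hx, h⟩
    · obtain ⟨x, hx, h⟩ := h₂.1 y hy; exact ⟨x, .inr hx, h⟩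
  · rintro y (hy | hy)
    · obtain ⟨x, hx, h⟩ := h₁.2 y hy; exact ⟨x, .inl hx, h⟩
    · obtain ⟨x, hx, h⟩ := h₂.2 y hy; exact ⟨x, .inr hx, h⟩

theorem BiRelated.image {α β : Type*} {r : α → α → Prop} {r' : β → β → Prop} {S S' : Set α}
    {f g : α → β} (h : BiRelated r S S') (hr : ∀ x y, r x y → r' (f x) (g y)) :
    BiRelated r' (f '' S) (g '' S') := by
  constructor
  · rintro _ ⟨y, hy, rfl⟩
    obtain ⟨x, hx, h⟩ := h.1 y hy
    exact ⟨_, ⟨x, hx, rfl⟩, hr _ _ h⟩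
  · rintro _ ⟨x, hx, rfl⟩
    obtain ⟨y, hy, h⟩ := h.2 x hx
    exact ⟨_, ⟨y, hy, rfl⟩, hr _ _ h⟩

/-! ### Evolution of synchrons and derivations under a transition. -/

/-- The change of a synchron under the occurrence of a transition with the set `A` of active
synchrons. -/
structure Step (A : Set (Synchron Ag Ch Bc Sg I)) (ς ς' : Synchron Ag Ch Bc Sg I) : Prop where
  leaf : ς'.leaf = ς.leaf
  args : ς'.args = ς.args ∨ ArgSucc ς.args ς'.args
  succ : A.Nonempty → ArgSucc ς.args ς'.args
  lt : ∀ υ ∈ A, component υ.args = component ς.args → dynCount ς'.args < dynCount ς.args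

theorem Step.cons_dynamic {A : Set (Synchron Ag Ch Bc Sg I)} {ς ς' : Synchron Ag Ch Bc Sg I}
    {x : Arg Ag Ch Bc Sg I} (hx : x.isStatic = false) (hA : A.Nonempty) (h : Step A ς ς') :
    Step (Synchron.cons x '' A) (ς.cons x) ς' where
  leaf := h.leaf
  args := .inr (.cons_dynamic hx (h.succ hA))
  succ _ := .cons_dynamic hx (h.succ hA)
  lt := by
    -- The component is irrelevant here: dropping `x` already lowers the count.
    rintro υ - -
    have : dynCount (ς.cons x).args = dynCount ς.args + 1 := by
      simp [Synchron.cons, dynCount, hx]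
    rcases (h.succ hA).dynCount_lt_or_eq with h | h
    · omega
    · rw [h]; omega

theorem dynCount_cons_static {x : Arg Ag Ch Bc Sg I} (hx : x.isStatic = true) (l) :
    dynCount (x :: l) = dynCount l := by
  simp [dynCount, hx]

theorem Step.cons_static {A : Set (Synchron Ag Ch Bc Sg I)} {ς ς' : Synchron Ag Ch Bc Sg I}
    {x : Arg Ag Ch Bc Sg I} (hx : x.isStatic = true)
    (hc : ∀ l, component (x :: l) = component l) (h : Step A ς ς') :
    Step (Synchron.cons x '' A) (ς.cons x) (ς'.cons x) where
  leaf := h.leaf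
  args := h.args.imp (by rintro h; simp [Synchron.cons, h]) (.cons_static hx)
  succ hA := .cons_static hx (h.succ (Set.image_nonempty.1 hA))
  lt := by
    rintro _ ⟨υ, hυ, rfl⟩
    simp only [Synchron.cons, hc, dynCount_cons_static hx]
    exact h.lt υ hυ

/-- Activity on side `e` lies in another component, so it never forces a decrease. The new head `par
d` makes an unchanged string an instance of `ArgSucc`, so `succ` holds even if side `d` is idle. -/
theorem Step.cons_par {A B : Set (Synchron Ag Ch Bc Sg I)} {ς ς' : Synchron Ag Ch Bc Sg I}
    {d e : Side} (hne : d ≠ e) (h : Step A ς ς') :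
    Step (Synchron.cons (.par d) '' A ∪ Synchron.cons (.par e) '' B)
      (ς.cons (.par d)) (ς'.cons (.par d)) where
  leaf := h.leaf
  args := h.args.imp (by rintro h; simp [Synchron.cons, h]) (.cons_static rfl)
  succ _ := by
    rcases h.args with h | h
    · simp only [Synchron.cons, h]; exact .par_refl _ _
    · exact .cons_static rfl h
  lt := by
    rintro _ (⟨υ, hυ, rfl⟩ | ⟨υ, hυ, rfl⟩) he
    · simp only [Synchron.cons, dynCount_cons_static (x := .par d) rfl] at he ⊢
      refine h.lt υ hυ ?_
      cases d <;> simpa [component] using he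
    · cases d <;> cases e <;> simp [Synchron.cons, component] at he hne

theorem Step.empty (ς : Synchron Ag Ch Bc Sg I) : Step ∅ ς ς where
  leaf := rfl
  args := .inl rfl
  succ := by simp
  lt := by simp

/-- The derivation `t` remains possible in the state `P'`, which has been reached by performing a
transition with the set `A` of active synchrons. -/
def Der.Persists {P ℓ Q} (t : Der D P ℓ Q) (A : Set (Synchron Ag Ch Bc Sg I))
    (P' : Proc Ag Ch Bc Sg I) : Prop :=
  (∀ ς ∈ t.necessarySynchrons, ∀ υ ∈ A, ς.DirConc υ) →
    ∃ R, ∃ t' : Der D P' ℓ R, BiRelated (Step A) t.necessarySynchrons t'.necessarySynchrons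

/-- In a state `P` either nothing happens, or a transition to `P'` with the set `A` of active
synchrons. -/
def Move (D : Ag → Proc Ag Ch Bc Sg I) (P : Proc Ag Ch Bc Sg I)
    (A : Set (Synchron Ag Ch Bc Sg I)) (P' : Proc Ag Ch Bc Sg I) : Prop :=
  A = ∅ ∧ P' = P ∨ ∃ α, ∃ u : Der D P (.act α) P', A = u.activeSynchrons

theorem Der.move {P ℓ P'} (u : Der D P ℓ P') : Move D P u.activeSynchrons P' := by
  cases ℓ with
  | act α => exact .inr ⟨α, u, rfl⟩
  | emit s => exact .inl ⟨u.activeSynchrons_emit, u.emit_target⟩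

/-- `Move` covers components that act, idle or emit, and thus treats all parallel rules uniformly.
-/
theorem Der.par_move {P Q ℓ R} (u : Der D (.par P Q) ℓ R) : ∃ P' Q' A B, R = .par P' Q' ∧
    Move D P A P' ∧ Move D Q B Q' ∧
    u.activeSynchrons = Synchron.cons (.par .left) '' A ∪ Synchron.cons (.par .right) '' B := by
  cases u with
  | parL χ _ _ | broL χ _ _ =>
    exact ⟨_, _, _, ∅, rfl, χ.move, .inl ⟨rfl, rfl⟩, by
      rw [Set.image_empty, Set.union_empty]; exact activeSynchrons_eq_image rfl⟩
  | parR _ ζ _ | broR _ ζ _ =>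
    exact ⟨_, _, ∅, _, rfl, .inl ⟨rfl, rfl⟩, ζ.move, by
      rw [Set.image_empty, Set.empty_union]; exact activeSynchrons_eq_image rfl⟩
  | comm χ ζ _ | broC χ ζ _ =>
    exact ⟨_, _, _, _, rfl, χ.move, ζ.move, activeSynchrons_eq_union rfl⟩

theorem Der.persists_of_move {P ℓ Q} {t : Der D P ℓ Q}
    (h : ∀ {α P'} (u : Der D P (.act α) P'), t.Persists u.activeSynchrons P') {A P'}
    (hm : Move D P A P') : t.Persists A P' := by
  rcases hm with ⟨rfl, rfl⟩ | ⟨α, u, rfl⟩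
  · exact fun _ => ⟨_, t, fun ς h => ⟨ς, h, .empty ς⟩, fun ς h => ⟨ς, h, .empty ς⟩⟩
  · exact h u

/-- Vacuous: both sets of synchrons are nonempty, and their members branch at a dynamic argument, so
they are not directly concurrent. -/
theorem Der.persists_of_ne {P ℓ Q P₁ ℓ₁ Q₁ P₂ α₂ Q₂ P'} {t : Der D P ℓ Q} {χ : Der D P₁ ℓ₁ Q₁}
    {ζ : Der D P₂ (.act α₂) Q₂} {x y : Arg Ag Ch Bc Sg I} {A}
    (ht : t.necessarySynchrons = Synchron.cons x '' χ.necessarySynchrons)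
    (hA : A = Synchron.cons y '' ζ.activeSynchrons) (hx : x.isStatic = false) (hne : x ≠ y) :
    t.Persists A P' := by
  intro h
  obtain ⟨ς, hς⟩ := χ.necessarySynchrons_nonempty
  obtain ⟨υ, hυ⟩ := ζ.activeSynchrons_nonempty
  have := h (ς.cons x) (ht ▸ ⟨ς, hς, rfl⟩) (υ.cons y) (hA ▸ ⟨υ, hυ, rfl⟩)
  rcases Synchron.dirConc_cons_iff.1 this with ⟨d, e, -, rfl, -⟩ | ⟨h, -⟩
  · simp [Arg.isStatic] at hx
  · exact absurd h hne

theorem Der.persists_of_leaf {P ℓ Q P' P₂ α₂ Q₂} {t : Der D P ℓ Q} {ζ : Der D P₂ (.act α₂) Q₂}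
    {l : Leaf Ag Ch Bc Sg I} (ht : t.synchrons = {⟨[], l⟩}) : t.Persists ζ.activeSynchrons P' := by
  intro h
  obtain ⟨ς, hς⟩ := t.necessarySynchrons_nonempty
  obtain ⟨υ, hυ⟩ := ζ.activeSynchrons_nonempty
  have hl : ς = ⟨[], l⟩ := by have := hς.1; rwa [ht] at this
  exact absurd (hl ▸ h ς hς υ hυ) (Synchron.not_dirConc_nil _ _)

/-- The step resolves the dynamic operator, so the successor of `χ` serves for `t` without a new
rule on top; only the old synchrons carry `x`. -/
theorem Der.Persists.dynamic {P ℓ Q P₁ Q₁ P₂ α₂ Q₂ P'} {t : Der D P ℓ Q} {χ : Der D P₁ ℓ Q₁}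
    {ζ : Der D P₂ (.act α₂) Q₂} {x : Arg Ag Ch Bc Sg I} {A}
    (h : χ.Persists ζ.activeSynchrons P')
    (ht : t.necessarySynchrons = Synchron.cons x '' χ.necessarySynchrons)
    (hA : A = Synchron.cons x '' ζ.activeSynchrons) (hx : x.isStatic = false) :
    t.Persists A P' := by
  intro hc
  subst hA
  rw [ht] at hc ⊢
  obtain ⟨R, t', ht'⟩ := h fun ς hς υ hυ => by
    rcases Synchron.dirConc_cons_iff.1 (hc _ ⟨ς, hς, rfl⟩ _ ⟨υ, hυ, rfl⟩) with
      ⟨d, e, -, rfl, -⟩ | ⟨-, h⟩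
    · simp [Arg.isStatic] at hx
    · exact h
  refine ⟨R, t', ?_⟩
  have := ht'.image (f := Synchron.cons x) (g := id)
    (fun _ _ => Step.cons_dynamic hx ζ.activeSynchrons_nonempty)
  rwa [Set.image_id] at this

/-- A static operator survives the step; `lift` reapplies its rule to the successor of `χ`. -/
theorem Der.Persists.static {P ℓ Q P₁ ℓ₁ Q₁ P₁' P'} {t : Der D P ℓ Q} {χ : Der D P₁ ℓ₁ Q₁}
    {x : Arg Ag Ch Bc Sg I} {A₁ A} (h : χ.Persists A₁ P₁')
    (ht : t.necessarySynchrons = Synchron.cons x '' χ.necessarySynchrons)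
    (hA : A = Synchron.cons x '' A₁) (hx : x.isStatic = true)
    (hc : ∀ l, component (x :: l) = component l)
    (lift : ∀ R₁ (χ' : Der D P₁' ℓ₁ R₁), ∃ R, ∃ t' : Der D P' ℓ R,
      t'.necessarySynchrons = Synchron.cons x '' χ'.necessarySynchrons) :
    t.Persists A P' := by
  intro hconc
  subst hA
  rw [ht] at hconc ⊢
  obtain ⟨R₁, χ', hχ'⟩ := h fun ς hς υ hυ => by
    rcases Synchron.dirConc_cons_iff.1 (hconc _ ⟨ς, hς, rfl⟩ _ ⟨υ, hυ, rfl⟩) with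
      ⟨d, e, hne, rfl, he⟩ | ⟨-, h⟩
    · exact absurd (Arg.par.inj he) hne
    · exact h
  obtain ⟨R, t', ht'⟩ := lift R₁ χ'
  exact ⟨R, t', ht' ▸ hχ'.image fun _ _ => Step.cons_static hx hc⟩

theorem Der.Persists.par {P ℓ Q P₁ ℓ₁ Q₁ P₁' P'} {t : Der D P ℓ Q} {χ : Der D P₁ ℓ₁ Q₁}
    {d e : Side} {A B S} (hne : d ≠ e) (h : χ.Persists A P₁')
    (ht : t.necessarySynchrons = Synchron.cons (.par d) '' χ.necessarySynchrons)
    (hS : S = Synchron.cons (.par d) '' A ∪ Synchron.cons (.par e) '' B)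
    (lift : ∀ R₁ (χ' : Der D P₁' ℓ₁ R₁), ∃ R, ∃ t' : Der D P' ℓ R,
      t'.necessarySynchrons = Synchron.cons (.par d) '' χ'.necessarySynchrons) :
    t.Persists S P' := by
  intro hconc
  subst hS
  rw [ht] at hconc ⊢
  obtain ⟨R₁, χ', hχ'⟩ := h fun ς hς υ hυ => by
    rcases Synchron.dirConc_cons_iff.1 (hconc _ ⟨ς, hς, rfl⟩ _ (.inl ⟨υ, hυ, rfl⟩)) with
      ⟨d', e', hne', h₁, h₂⟩ | ⟨-, h⟩
    · exact absurd ((Arg.par.inj h₁).symm.trans (Arg.par.inj h₂)) hne'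
    · exact h
  obtain ⟨R, t', ht'⟩ := lift R₁ χ'
  exact ⟨R, t', ht' ▸ hχ'.image fun _ _ => Step.cons_par hne⟩

theorem Der.Persists.comm {P P' Q Q' c c' P₁ Q₁ A B S} {χ : Der D P c P'} {ζ : Der D Q c' Q'}
    (hχ : χ.Persists A P₁) (hζ : ζ.Persists B Q₁) (h : Label.Compl c c')
    (hS : S = Synchron.cons (.par .left) '' A ∪ Synchron.cons (.par .right) '' B) :
    (Der.comm χ ζ h).Persists S (.par P₁ Q₁) := by
  intro hconc
  subst hS
  rw [necessarySynchrons_comm] at hconc ⊢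
  obtain ⟨R, χ', hχ'⟩ := hχ fun ς hς υ hυ => by
    have := hconc _ (.inl ⟨ς, hς, rfl⟩) _ (.inl ⟨υ, hυ, rfl⟩)
    simpa [Synchron.dirConc_cons_iff, eq_comm] using this
  obtain ⟨R', ζ', hζ'⟩ := hζ fun ς hς υ hυ => by
    have := hconc _ (.inr ⟨ς, hς, rfl⟩) _ (.inr ⟨υ, hυ, rfl⟩)
    simpa [Synchron.dirConc_cons_iff, eq_comm] using this
  refine ⟨_, .comm χ' ζ' h, ?_⟩
  rw [necessarySynchrons_comm]
  refine .union (hχ'.image fun _ _ => Step.cons_par (by simp)) (hζ'.image fun _ _ hs => ?_)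
  rw [Set.union_comm]
  exact hs.cons_par (by simp)

end Persistence

/-! ### Persistence of arbitrary derivations. -/

section Feasibility

universe u₁ u₂ u₃ u₄ u₅ u₆

variable {Ag : Type u₁} {Ch : Type u₂} {Bc : Type u₃} {Sg : Type u₄} {J : Type u₅}
  {I : J → Type u₆} {D : Ag → Proc Ag Ch Bc Sg I}

/-- The label is left general so that case analysis can unify it with `f.onLabel`; the premise may
then be an emission, which `Move` absorbs. -/
theorem Der.rel_move {P f ℓ R} (u : Der D (.rel P f) ℓ R) : ∃ A P', R = .rel P' f ∧
    Move D P A P' ∧ u.activeSynchrons = Synchron.cons (.rel f) '' A := by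
  cases u with
  | rel χ _ => exact ⟨_, _, rfl, χ.move, activeSynchrons_eq_image rfl⟩

/-- An unaffected derivation persists. -/
theorem Der.persists (H : ReceiveComplete D) {P ℓ Q} (t : Der D P ℓ Q) :
    (¬ ∃ b, ℓ = .act (.bro .receive b)) → ∀ {α P'} (u : Der D P (.act α) P'),
      t.Persists u.activeSynchrons P' := by
  induction t with
  | pre | emit => intro _ α P' u; exact persists_of_leaf rfl
  | sumL χ _ ih | sumEmitL χ _ ih =>
    intro hℓ α P' u
    cases u with
    | sumL ζ _ =>
      exact (ih hℓ ζ).dynamic (necessarySynchrons_eq_image rfl Iff.rfl)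
        (activeSynchrons_eq_image rfl) rfl
    | sumR _ ζ =>
      exact persists_of_ne (necessarySynchrons_eq_image (χ := χ) rfl Iff.rfl)
        (activeSynchrons_eq_image (χ := ζ) rfl) rfl (by simp)
  | sumR _ χ ih | sumEmitR _ χ ih =>
    intro hℓ α P' u
    cases u with
    | sumL ζ _ =>
      exact persists_of_ne (necessarySynchrons_eq_image (χ := χ) rfl Iff.rfl)
        (activeSynchrons_eq_image (χ := ζ) rfl) rfl (by simp)
    | sumR _ ζ =>
      exact (ih hℓ ζ).dynamic (necessarySynchrons_eq_image rfl Iff.rfl)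
        (activeSynchrons_eq_image rfl) rfl
  | @choice k _ _ P j χ ih | @choiceEmit k _ _ P j χ ih =>
    intro hℓ α P' u
    cases u with
    | choice _ j' ζ =>
      by_cases hj : j = j'
      · subst hj
        exact (ih hℓ ζ).dynamic (necessarySynchrons_eq_image rfl Iff.rfl)
          (activeSynchrons_eq_image rfl) rfl
      · exact persists_of_ne (x := .choice k j) (y := .choice k j')
          (necessarySynchrons_eq_image (χ := χ) rfl Iff.rfl)
          (activeSynchrons_eq_image (χ := ζ) rfl) rfl (by simp [hj])
  | ident χ ih | identEmit χ ih =>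
    intro hℓ α P' u
    cases u with
    | ident ζ =>
      exact (ih hℓ ζ).dynamic (necessarySynchrons_eq_image rfl Iff.rfl)
        (activeSynchrons_eq_image rfl) rfl
  | signalAct χ r ih | signalEmit χ r ih =>
    intro hℓ α P' u
    cases u with
    | signalAct ζ _ =>
      exact (ih hℓ ζ).dynamic (necessarySynchrons_eq_image rfl Iff.rfl)
        (activeSynchrons_eq_image rfl) rfl
  | res χ L h ih =>
    intro hℓ α P' u
    cases u with
    | res ζ _ _ =>
      exact (ih hℓ ζ).static (necessarySynchrons_eq_image rfl Iff.rfl)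
        (activeSynchrons_eq_image rfl) rfl (fun _ => rfl)
        fun _ χ' => ⟨_, .res χ' L h, necessarySynchrons_eq_image rfl Iff.rfl⟩
  | rel χ f ih =>
    intro hℓ α P' u
    obtain ⟨A, P', rfl, hm, hA⟩ := u.rel_move
    exact (persists_of_move (ih fun h => hℓ (Relabelling.onLabel_eq_bro.2 h)) hm).static
      (necessarySynchrons_eq_image rfl Relabelling.onLabel_eq_bro) hA rfl (fun _ => rfl)
      fun _ χ' => ⟨_, .rel χ' f, necessarySynchrons_eq_image rfl Relabelling.onLabel_eq_bro⟩
  | parL χ _ h ih =>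
    intro hℓ α P' u
    obtain ⟨P', Q', A, B, rfl, hA, -, hS⟩ := u.par_move
    exact (persists_of_move (ih hℓ) hA).par (by simp) (necessarySynchrons_eq_image rfl Iff.rfl) hS
      fun _ χ' => ⟨_, .parL χ' Q' h, necessarySynchrons_eq_image rfl Iff.rfl⟩
  | parR _ ζ h ih =>
    intro hℓ α P' u
    obtain ⟨P', Q', A, B, rfl, -, hB, hS⟩ := u.par_move
    rw [Set.union_comm] at hS
    exact (persists_of_move (ih hℓ) hB).par (by simp) (necessarySynchrons_eq_image rfl Iff.rfl) hS
      fun _ ζ' => ⟨_, .parR P' ζ' h, necessarySynchrons_eq_image rfl Iff.rfl⟩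
  | comm χ ζ h ih ih' =>
    intro hℓ α P' u
    obtain ⟨P', Q', A, B, rfl, hA, hB, hS⟩ := u.par_move
    exact (persists_of_move (ih (h.not_bro _).1) hA).comm
      (persists_of_move (ih' (h.not_bro _).2) hB) h hS
  | @broL P P₁ m b χ Q h ih =>
    intro hℓ α P' u
    obtain ⟨P', Q', A, B, rfl, hA, -, hS⟩ := u.par_move
    cases m with
    | receive => exact absurd ⟨b, rfl⟩ hℓ
    | send =>
      exact (persists_of_move (ih hℓ) hA).par (by simp)
        (necessarySynchrons_eq_image rfl Iff.rfl) hS fun _ χ' => H.send_parL χ' Q'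
  | @broR Q Q₁ m b P ζ h ih =>
    intro hℓ α P' u
    obtain ⟨P', Q', A, B, rfl, -, hB, hS⟩ := u.par_move
    rw [Set.union_comm] at hS
    cases m with
    | receive => exact absurd ⟨b, rfl⟩ hℓ
    | send =>
      exact (persists_of_move (ih hℓ) hB).par (by simp)
        (necessarySynchrons_eq_image rfl Iff.rfl) hS fun _ ζ' => H.send_parR P' ζ'
  | @broC P P₁ Q Q₁ m₁ m₂ m b χ ζ h ih ih' =>
    intro hℓ α P' u
    obtain ⟨P', Q', A, B, rfl, hA, hB, hS⟩ := u.par_move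
    -- Only the sender's derivation is carried along; the partner may have changed, so its
    -- participation is decided anew.
    cases m₁ <;> cases m₂ <;> cases h
    · exact (persists_of_move (ih (by simp)) hA).par (by simp)
        (χ.necessarySynchrons_broC_left ζ) hS fun _ χ' => H.send_parL χ' Q'
    · rw [Set.union_comm] at hS
      exact (persists_of_move (ih' (by simp)) hB).par (by simp)
        (χ.necessarySynchrons_broC_right ζ) hS fun _ ζ' => H.send_parR P' ζ'
    · exact absurd ⟨b, rfl⟩ hℓ

/-! ## Feasibility of justness -/

/-- The necessary synchrons of `χ` are possible successors of those of `χ₀`, and `ς` is an active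
one among them. -/
def Der.Marks {P₀ ℓ₀ Q₀ P ℓ Q} (χ₀ : Der D P₀ ℓ₀ Q₀) (χ : Der D P ℓ Q)
    (ς : Synchron Ag Ch Bc Sg I) : Prop :=
  (∀ ς' ∈ χ.necessarySynchrons, ∃ ς₀ ∈ χ₀.necessarySynchrons, ς₀.Succ ς') ∧
    ς ∈ χ.activeSynchrons ∩ χ.necessarySynchrons

/-- `χ` has an active synchron in the parallel component `k`. -/
def Der.Hits {P ℓ Q} (χ : Der D P ℓ Q) (k : List Bool) : Prop :=
  ∃ υ ∈ χ.activeSynchrons, component υ.args = k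

theorem Der.exists_marks {P ℓ Q} (χ : Der D P ℓ Q) (h : ℓ ∈ actLabels Ch Bc Sg) :
    ∃ ς, χ.Marks χ ς := by
  obtain ⟨α, rfl⟩ := h
  obtain ⟨ς, h₁, h₂⟩ := χ.exists_necessary_active
  exact ⟨ς, fun ς' h => ⟨ς', h, .refl _⟩, ⟨h₁.1, h₂⟩, h₁⟩

theorem Der.Marks.hits {P₀ ℓ₀ Q₀ P ℓ Q} {χ₀ : Der D P₀ ℓ₀ Q₀} {χ : Der D P ℓ Q}
    {ς : Synchron Ag Ch Bc Sg I} (h : χ₀.Marks χ ς) : χ.Hits (component ς.args) :=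
  ⟨ς, h.2.1, rfl⟩

/-- Both halves of `BiRelated` are used: tracing new necessary synchrons back keeps the link with
`χ₀`, and following `ς` forward yields the new mark. -/
theorem Der.Marks.persist (H : ReceiveComplete D) {P₀ ℓ₀ Q₀ P ℓ Q ℓ' P'}
    {χ₀ : Der D P₀ ℓ₀ Q₀} {χ : Der D P ℓ Q} {ς : Synchron Ag Ch Bc Sg I} (h : χ₀.Marks χ ς)
    (hℓ : ¬ ∃ b, ℓ = .act (.bro .receive b)) (u : Der D P ℓ' P')
    (hℓ' : ℓ' ∈ actLabels Ch Bc Sg) (hu : χ₀.Unaffected u) :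
    ∃ R, ∃ χ' : Der D P' ℓ R, ∃ ς', χ₀.Marks χ' ς' ∧ (dynCount ς'.args < dynCount ς.args ∨
      component ς'.args = component ς.args ∧ dynCount ς'.args = dynCount ς.args ∧
        ¬ u.Hits (component ς.args)) := by
  obtain ⟨α, rfl⟩ := hℓ'
  -- Concurrency with `u` passes from `χ₀` to its descendant `χ`, and becomes direct because `χ` and
  -- `u` share their source.
  obtain ⟨R, χ', hb⟩ := χ.persists H hℓ u fun ς₁ h₁ υ hυ => by
    obtain ⟨ς₀, h₀, hs⟩ := h.1 ς₁ h₁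
    exact ((hu ς₀ h₀ υ hυ).succ_left hs).dirConc (χ.argPath ς₁ h₁.1) (u.argPath υ hυ.1)
  obtain ⟨ς', hς', hs⟩ := hb.2 ς h.2.2
  refine ⟨R, χ', ς', ⟨fun ς₂ h₂ => ?_, ⟨hς'.1, ?_⟩, hς'⟩, ?_⟩
  · obtain ⟨ς₁, h₁, hs₁⟩ := hb.1 ς₂ h₂
    obtain ⟨ς₀, h₀, hs₀⟩ := h.1 ς₁ h₁
    exact ⟨ς₀, h₀, hs₀.trans (Synchron.succ_iff.2 ⟨hs₁.leaf, hs₁.args⟩)⟩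
  · obtain ⟨β, Q, e⟩ := h.2.1.2
    exact ⟨β, Q, hs.leaf.trans e⟩
  · by_cases hh : u.Hits (component ς.args)
    · obtain ⟨υ, hυ, e⟩ := hh
      exact .inl (hs.lt υ hυ e)
    · rcases hs.args with e | e
      · exact .inr ⟨by rw [e], by rw [e], hh⟩
      · rcases e.dynCount_lt_or_eq with e | e
        · exact .inl e
        · exact .inr ⟨by rw [e], by rw [e], hh⟩

theorem fullLTSC_justnessFeasible (H : ReceiveComplete D) : (fullLTSC D).JustnessFeasible := by
  intro B _ _
  refine LTSC.feasible_isJust_of_marks B (fun t₀ t ς => Der.Marks t₀.der t.der ς)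
    (fun ς => component ς.args) (fun ς => dynCount ς.args) (fun u k => u.der.Hits k) ?_
    (fun _ _ _ h => h.hits) ?_
  · rintro t ⟨h, -⟩
    exact t.der.exists_marks h
  · rintro t₀ ⟨P, ℓ, Q, χ⟩ ς ⟨P₁, ℓ', P', u⟩ - hB hm rfl hℓ' hu
    obtain ⟨R, χ', ς', h₁, h₂⟩ := hm.persist H hB.2.1 u hℓ' hu
    exact ⟨⟨P', ℓ, R, χ'⟩, ς', hB, rfl, h₁, h₂⟩

theorem actionLTSC_justnessFeasible (H : ReceiveComplete D) :
    (actionLTSC D).JustnessFeasible := by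
  intro B _ _
  refine LTSC.feasible_isJust_of_marks B (fun t₀ t ς => Der.Marks t₀.1.der t.1.der ς)
    (fun ς => component ς.args) (fun ς => dynCount ς.args) (fun u k => u.1.der.Hits k) ?_
    (fun _ _ _ h => h.hits) ?_
  · rintro t -
    exact t.1.der.exists_marks t.2
  · rintro t₀ ⟨⟨P, ℓ, Q, χ⟩, hℓ⟩ ς ⟨⟨P₁, ℓ', P', u⟩, hℓ'⟩ - hB hm rfl - hu
    obtain ⟨R, χ', ς', h₁, h₂⟩ := hm.persist H hB.2.1 u hℓ' hu
    exact ⟨⟨⟨P', ℓ, R, χ'⟩, hℓ⟩, ς', hB, rfl, h₁, h₂⟩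

theorem receiveComplete_of_isEmpty [IsEmpty Bc] (D : Ag → Proc Ag Ch Bc Sg I) :
    ReceiveComplete D :=
  fun _ b => isEmptyElim b

theorem receiveComplete_of_guarded (hD : ∀ A, (D A).Guarded) : ReceiveComplete D :=
  fun _ _ => (canReceive_iff hD).1

/-! ## Uncountable branching -/

/-- The initial transitions of `∑_{i ∈ I k} τ.0`. -/
def choiceTau (D : Ag → Proc Ag Ch Bc Sg I) (k : J) (j : I k) : Derivation D where
  source := .choice k fun _ => .pre .tau .nil
  label := .act .tau
  target := .nil
  der := .choice _ j (.pre .tau .nil)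

/-- These derivations agree in source, label and target, but the argument in their synchron records
`j`. -/
theorem choiceTau_injective (D : Ag → Proc Ag Ch Bc Sg I) (k : J) :
    Function.Injective (choiceTau D k) := by
  intro j j' h
  have h := congrArg (fun t : Derivation D => t.der.synchrons) h
  simpa [choiceTau, Der.synchrons, Synchron.cons] using h

theorem actionLTSC_uncountablyBranching (D : Ag → Proc Ag Ch Bc Sg I) {k : J}
    [Uncountable (I k)] : (actionLTSC D).UncountablyBranching := by
  refine ⟨.choice k fun _ => .pre .tau .nil, fun hc => ?_⟩
  let f : I k → (actionLTSC D).Tr := fun j => ⟨choiceTau D k j, .tau, rfl⟩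
  have hf : Function.Injective f := fun j j' h => choiceTau_injective D k (congrArg Subtype.val h)
  refine not_countable (α := I k) (Set.countable_univ_iff.1 ?_)
  have hrec : (.act .tau : Label Ch Bc Sg) ∉ recLabels Ch Bc Sg := by
    rintro ⟨b, h⟩
    cases h
  have hmem : ∀ j, (actionLTSC D).NonBlocking ∅ (f j) ∧
      (actionLTSC D).src (f j) = .choice k fun _ => .pre .tau .nil :=
    fun j => ⟨⟨⟨.tau, rfl⟩, hrec, fun h => h⟩, rfl⟩
  exact (hc.preimage hf).mono fun j _ => hmem j

end Feasibility

end Justness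

/-! ### The languages CCS, ABC and CCSS. -/

theorem mainTheorem7 {Ag Ch Bc Sg J : Type*} (I : J → Type*) :
    ((∀ D : Ag → CCS Ag Ch I, (actionLTSC D).JustnessFeasible) ∧
      (∀ D : Ag → ABC Ag Ch Bc I, (∀ A, (D A).Guarded) → (actionLTSC D).JustnessFeasible) ∧
      (∀ D : Ag → CCSS Ag Ch Sg I,
        (actionLTSC D).JustnessFeasible ∧ (fullLTSC D).JustnessFeasible)) ∧
    ((∃ k, Uncountable (I k)) →
      (∀ D : Ag → CCS Ag Ch I, (actionLTSC D).UncountablyBranching) ∧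
      (∀ D : Ag → ABC Ag Ch Bc I, (actionLTSC D).UncountablyBranching) ∧
      (∀ D : Ag → CCSS Ag Ch Sg I, (actionLTSC D).UncountablyBranching)) := by
  refine ⟨⟨fun D => actionLTSC_justnessFeasible (receiveComplete_of_isEmpty D),
    fun D hD => actionLTSC_justnessFeasible (receiveComplete_of_guarded hD),
    fun D => ⟨actionLTSC_justnessFeasible (receiveComplete_of_isEmpty D),
      fullLTSC_justnessFeasible (receiveComplete_of_isEmpty D)⟩⟩, ?_⟩
  rintro ⟨k, hk⟩
  exact ⟨fun D => actionLTSC_uncountablyBranching D (k := k),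
    fun D => actionLTSC_uncountablyBranching D (k := k),
    fun D => actionLTSC_uncountablyBranching D (k := k)⟩
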